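/- Let $\mathbb{K}$ be a perfect field (for instance an algebraically closed field or a field of characteristic $0$), let $N$ be a lattice (a free abelian group of finite rank $d$) and $M=\mathrm{Hom}(N,\mathbb{Z})$. Let $X=X_\Sigma$ be a smooth toric Fano variety given by a (finite) fan $\Sigma$ in $N_{\mathbb{R}}$: the fan is complete, for every cone the primitive integral vectors $n_\rho$ along its rays are part of a basis of $N$, and there is a strictly convex integral piecewise linear function $F$ on $\Sigma$ with $F(n_\rho)=-1$ for all rays $\rho\in\Sigma^1$ (i.e. $-K_X=\sum_\rho D_\rho$ is ample; strict convexity means $F(tn+(1-t)n')\ge tF(n)+(1-t)F(n')$ for $0\le t\le 1$ and that the maximal linearity domains of $F$ are cones of $\Sigma$). Let $$\Delta=\{m\in M_{\mathbb{R}} : (m,n_\rho)\ge -1\ \text{for all}\ \rho\in\Sigma^1\},\qquad \Delta^*=\{n\in N_{\mathbb{R}} : (m,n)\ge -1\ \text{for all}\ m\in\Delta\},$$ and let $X^*=\mathrm{Proj}\bigoplus_{k\ge0}\mathrm{Span}_{\mathbb{K}}\{x^nt^k : n\in k\Delta^*\cap N\}$ be the dual toric Fano variety, i.e. the projective toric variety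 over $\mathbb{K}$ of the polytope $\Delta^*$, so that $\mathcal{O}(1)=\mathcal{O}_{X^*}(-K_{X^*})$ and the big orbit of $X^*$ is the torus $T_M=\mathrm{Spec}\,\mathbb{K}[N]$. Let $W=\sum_{\rho\in\Sigma^1} b_\rho x^{n_\rho}$ with $b_\rho\in\mathbb{K}$, all $b_\rho\ne0$, regarded both as a function on $T_M$ and as a section of $\mathcal{O}_{X^*}(-K_{X^*})$. For $m\in M$ let $\partial_m$ be the log-derivative, $\partial_m x^n=(m,n)x^n$. Let $Z_W\subset X^*$ be the closed subscheme defined by the ideal sheaf $\mathcal{J}_W$ such that $\mathcal{J}_W(-K_{X^*})\subset\mathcal{O}_{X^*}(-K_{X^*})$ is generated by the sections $\partial_mW$, $m\in M$, and let $J_W\subset\mathbb{K}[N]$ be the ideal generated by the functions $\partial_mW$, $m\in M$. A point $p\in T_M$ is a critical point of $W$ if $\partial_mW(p)=0$ in the residue field $\kappa(p)$ for all $m\in M$; it is non-degenerate if the Hessian $(\partial_{m_i}\partial_{m_j}W(p))_{i,j}$ is an invertible matrix over $\kappa(p)$, where $m_1,\dots,m_d$ is a basis of $M$. A finite dimensional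 commutative $\mathbb{K}$-algebra is semisimple if it has no non-zero nilpotent elements; a commutative $\mathbb{K}$-algebra contains a field as a direct summand if it is isomorphic, as a $\mathbb{K}$-algebra, to $L\oplus A'$ with $L/\mathbb{K}$ a field extension and $A'$ a commutative $\mathbb{K}$-algebra. Then the $\mathbb{K}$-algebra $\mathcal{O}(Z_W)$ is finite dimensional, $\mathcal{O}(Z_W)\cong\mathbb{K}[N]/J_W$, and: (i) $\mathcal{O}(Z_W)$ is semisimple if and only if all critical points of $W$ on $T_M$ are non-degenerate; (ii) $\mathcal{O}(Z_W)$ contains a field as a direct summand if and only if $W$ has a non-degenerate critical point on $T_M$. -/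

import Mathlib

open scoped TensorProduct DirectSum
open AlgebraicGeometry

noncomputable section

namespace ToricFano

universe u v

/-! ### Lattices, cones and fans -/

/-- The real vector space `N_ℝ = ℝ ⊗ N` of a lattice `N`. -/
abbrev RealSpace (N : Type v) [AddCommGroup N] : Type v := ℝ ⊗[ℤ] N

/-- The inclusion of the lattice `N` into `N_ℝ`. -/
def toReal {N : Type v} [AddCommGroup N] (n : N) : RealSpace N := (1 : ℝ) ⊗ₜ[ℤ] n

section Cones

variable {N : Type v} [AddCommGroup N]

/-- A cone in `N_ℝ` that is spanned over `ℝ≥0` by finitely many lattice vectors. -/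
def IsRationalPolyhedral (σ : PointedCone ℝ (RealSpace N)) : Prop :=
  ∃ s : Finset N, σ = PointedCone.hull ℝ (toReal '' (s : Set N))

/-- A cone that contains no line, `σ ∩ (-σ) = {0}`. -/
def IsStrictlyConvexCone (σ : PointedCone ℝ (RealSpace N)) : Prop :=
  ∀ x, x ∈ σ → -x ∈ σ → x = 0

/-- `τ` is a face of `σ`: the intersection of `σ` with a supporting hyperplane `ker m`, where
`m ∈ M_ℝ` is non-negative on `σ`. -/
def IsFace (τ σ : PointedCone ℝ (RealSpace N)) : Prop :=
  ∃ m : Module.Dual ℝ (RealSpace N), (∀ x ∈ σ, 0 ≤ m x) ∧ ∀ x, x ∈ τ ↔ x ∈ σ ∧ m x = 0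

/-- A lattice vector is primitive if it is not a proper integral multiple of a lattice vector
(in particular it is non-zero). -/
def IsPrimitive (n : N) : Prop := ∀ (k : ℤ) (n' : N), n = k • n' → IsUnit k

variable (N) in
/-- A (finite) fan of strictly convex rational polyhedral cones in `N_ℝ`. -/
structure Fan where
  /-- the cones of the fan -/
  cones : Set (PointedCone ℝ (RealSpace N))
  finite : cones.Finite
  rational : ∀ σ ∈ cones, IsRationalPolyhedral σ
  strictlyConvex : ∀ σ ∈ cones, IsStrictlyConvexCone σ
  face_mem : ∀ σ ∈ cones, ∀ τ, IsFace τ σ → τ ∈ cones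
  inter_face : ∀ σ ∈ cones, ∀ τ ∈ cones, IsFace (σ ⊓ τ) σ ∧ IsFace (σ ⊓ τ) τ

namespace Fan

/-- The primitive integral vectors `n_ρ` along the rays `ρ` of the fan. Since `ρ` is the cone
`ℝ≥0 n_ρ`, the rays and these vectors determine each other, and the set `Σ¹` of rays is
represented by this set. -/
def rayVectors (S : Fan N) : Set N :=
  {n | IsPrimitive n ∧ PointedCone.hull ℝ {toReal n} ∈ S.cones}

/-- The fan is complete: its cones cover `N_ℝ`. -/
def IsComplete (S : Fan N) : Prop := ∀ x : RealSpace N, ∃ σ ∈ S.cones, x ∈ σ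

/-- The fan of a smooth toric variety: for every cone, the primitive integral vectors along its
rays are part of a basis of `N`. -/
def IsSmooth (S : Fan N) : Prop :=
  ∀ σ ∈ S.cones, ∃ e : Module.Basis (Fin (Module.finrank ℤ N)) ℤ N,
    ∀ n ∈ S.rayVectors, toReal n ∈ σ → n ∈ Set.range e

/-- `F` is an integral piecewise linear function on the fan: on every cone it coincides with a
linear function that takes integral values on `N`. -/
def IsIntegralPiecewiseLinear (S : Fan N) (F : RealSpace N → ℝ) : Prop :=
  ∀ σ ∈ S.cones, ∃ m : Module.Dual ℝ (RealSpace N),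
    (∀ n : N, ∃ k : ℤ, m (toReal n) = k) ∧ ∀ x ∈ σ, F x = m x

/-- Strict convexity of a piecewise linear function on the fan, with the sign convention usual
for toric varieties: `F (t n + (1 - t) n') ≥ t F n + (1 - t) F n'`, and the maximal linearity
domains of `F` are cones of the fan. -/
def IsStrictlyConvexOn (S : Fan N) (F : RealSpace N → ℝ) : Prop :=
  ConcaveOn ℝ Set.univ F ∧
    ∀ D : Set (RealSpace N), Convex ℝ D →
      (∃ m : Module.Dual ℝ (RealSpace N), ∀ x ∈ D, F x = m x) →
      ∃ σ ∈ S.cones, D ⊆ (σ : Set (RealSpace N))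

/-- The fan of a toric Fano variety `X_Σ`: the fan is complete, and the anticanonical divisor
`-K = ∑ D_ρ` is Cartier and ample, that is, it is the divisor `-∑ F(n_ρ) D_ρ` of a strictly convex
integral piecewise linear function `F` (so `F(n_ρ) = -1` for every ray `ρ`). -/
def IsFano (S : Fan N) : Prop :=
  S.IsComplete ∧ ∃ F : RealSpace N → ℝ, S.IsIntegralPiecewiseLinear F ∧
    S.IsStrictlyConvexOn F ∧ ∀ n ∈ S.rayVectors, F (toReal n) = -1

/-- The polytope `Δ = {m ∈ M_ℝ | (m, n_ρ) ≥ -1 for every ρ}` of the anticanonical divisor, where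
`M_ℝ` is the dual space of `N_ℝ`. -/
def polytope (S : Fan N) : Set (Module.Dual ℝ (RealSpace N)) :=
  {m | ∀ n ∈ S.rayVectors, -1 ≤ m (toReal n)}

/-- The dual polytope `Δ* = {n ∈ N_ℝ | (m, n) ≥ -1 for every m ∈ Δ}`. -/
def dualPolytope (S : Fan N) : Set (RealSpace N) :=
  {x | ∀ m ∈ S.polytope, -1 ≤ m x}

/-- The semigroup of lattice points `(n, k)` of the cone over `Δ*`: those with `n ∈ k Δ*`, that is,
`(m, n) ≥ -k` for every `m ∈ Δ`. -/
def coneSemigroup (S : Fan N) : AddSubmonoid (N × ℕ) where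
  carrier := {a | ∀ m ∈ S.polytope, -(a.2 : ℝ) ≤ m (toReal a.1)}
  zero_mem' := by
    intro m _
    simp [toReal]
  add_mem' := by
    intro a c ha hc m hm
    have h1 := ha m hm
    have h2 := hc m hm
    simp only [Prod.snd_add, Prod.fst_add, toReal, TensorProduct.tmul_add, map_add, Nat.cast_add]
      at h1 h2 ⊢
    linarith

theorem mem_coneSemigroup_iff (S : Fan N) (n : N) {k : ℕ} (hk : 0 < k) :
    (n, k) ∈ S.coneSemigroup ↔ ∃ x ∈ S.dualPolytope, toReal n = (k : ℝ) • x := by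
  have hk' : (0 : ℝ) < k := by exact_mod_cast hk
  constructor
  · intro h
    refine ⟨(k : ℝ)⁻¹ • toReal n, fun m hm => ?_, (smul_inv_smul₀ hk'.ne' _).symm⟩
    have h1 : -(k : ℝ) ≤ m (toReal n) := h m hm
    rw [map_smul, smul_eq_mul]
    have h2 := mul_le_mul_of_nonneg_left h1 (inv_nonneg.mpr hk'.le)
    rwa [mul_neg, inv_mul_cancel₀ hk'.ne'] at h2
  · rintro ⟨x, hx, h⟩ m hm
    change -(k : ℝ) ≤ m (toReal n)
    rw [h, map_smul, smul_eq_mul]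
    nlinarith [hx m hm]

/-- The degree `(n, k) ↦ k` on the cone over `Δ*`. -/
def degree (S : Fan N) : S.coneSemigroup →+ ℕ :=
  (AddMonoidHom.snd N ℕ).comp S.coneSemigroup.subtype

/-- The projection `(n, k) ↦ n`. -/
def lattice (S : Fan N) : S.coneSemigroup →+ N :=
  (AddMonoidHom.fst N ℕ).comp S.coneSemigroup.subtype

theorem ray_mem_coneSemigroup (S : Fan N) (ρ : S.rayVectors) : (ρ.1, 1) ∈ S.coneSemigroup := by
  intro m hm
  simpa using hm ρ.1 ρ.2

section Finiteness

variable [Module.Free ℤ N] [Module.Finite ℤ N]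

theorem eq_of_hull_eq {n n' : N} (hn : IsPrimitive n) (hn' : IsPrimitive n')
    (h : PointedCone.hull ℝ {toReal n} = PointedCone.hull ℝ {toReal n'}) : n = n' := by
  have hmem : toReal n ∈ PointedCone.hull ℝ {toReal n'} := by
    rw [← h]; exact PointedCone.subset_hull rfl
  obtain ⟨a, ha⟩ := Submodule.mem_span_singleton.mp hmem
  let b := Module.Free.chooseBasis ℤ N
  have hrepr : ∀ (x : N) i, (b.baseChange ℝ).repr (toReal x) i = (b.repr x i : ℝ) := by
    intro x i
    simp [toReal, Module.Basis.baseChange_repr_tmul]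
  have hcoord : ∀ i, (b.repr n i : ℝ) = (a : ℝ) * (b.repr n' i : ℝ) := by
    intro i
    rw [← hrepr, ← hrepr, ← ha]
    have : a • toReal n' = (a : ℝ) • toReal n' := rfl
    rw [this, map_smul]
    rfl
  have hne : n' ≠ 0 := by
    rintro rfl
    have := hn' 2 0 (by simp)
    exact absurd this (by decide)
  obtain ⟨i, hi⟩ : ∃ i, b.repr n' i ≠ 0 := by
    by_contra! hcon
    exact hne (b.repr.map_eq_zero_iff.mp (Finsupp.ext hcon))
  have hrel : b.repr n' i • n = b.repr n i • n' := by
    apply b.repr.injective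
    ext j
    simp only [map_smul, Finsupp.smul_apply, smul_eq_mul]
    have h1 := hcoord i
    have h2 := hcoord j
    have : (b.repr n' i : ℝ) * b.repr n j = b.repr n i * b.repr n' j := by
      rw [h1, h2]; ring
    exact_mod_cast this
  obtain ⟨q, p, hg, hq, hp⟩ := Int.exists_gcd_one (m := b.repr n' i) (n := b.repr n i)
    (Int.gcd_pos_of_ne_zero_left _ hi)
  set g : ℤ := ((b.repr n' i).gcd (b.repr n i) : ℤ) with hgdef
  have hg0 : g ≠ 0 := by
    intro h0
    rw [h0, mul_zero] at hq
    exact hi hq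
  have hrel' : q • n = p • n' := by
    have : g • (q • n) = g • (p • n') := by
      rw [smul_smul, smul_smul, mul_comm g q, mul_comm g p, ← hq, ← hp, hrel]
    exact smul_right_injective N hg0 this
  obtain ⟨u, v, huv⟩ := Int.isCoprime_iff_gcd_eq_one.mpr hg
  have hpu : IsUnit p := hn p (u • n' + v • n) (by
    calc n = (u * q + v * p) • n := by rw [huv, one_smul]
      _ = u • (q • n) + (v * p) • n := by rw [add_smul, mul_smul]
      _ = _ := by rw [hrel']; module)
  have hqu : IsUnit q := hn' q (u • n' + v • n) (by
    calc n' = (u * q + v * p) • n' := by rw [huv, one_smul]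
      _ = v • (p • n') + (u * q) • n' := by rw [add_smul, mul_smul v p, add_comm]
      _ = _ := by rw [← hrel']; module)
  have hcases : n = n' ∨ n = -n' := by
    rcases Int.isUnit_iff.mp hpu with rfl | rfl <;> rcases Int.isUnit_iff.mp hqu with rfl | rfl
    · left; simpa using hrel'
    · right; rw [← neg_eq_iff_eq_neg]; simpa using hrel'
    · right; simpa using hrel'
    · left; simpa using hrel'
  rcases hcases with h' | h'
  · exact h'
  · exfalso
    have h1 := hcoord i
    have hi' : (b.repr n' i : ℝ) ≠ 0 := by exact_mod_cast hi
    rw [h', map_neg, Finsupp.neg_apply, Int.cast_neg] at h1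
    have h2 : ((a : ℝ) + 1) * (b.repr n' i : ℝ) = 0 := by linarith
    have h3 : (0 : ℝ) ≤ a := a.2
    rcases mul_eq_zero.mp h2 with h4 | h4
    · linarith
    · exact hi' h4

theorem finite_rayVectors (S : Fan N) : S.rayVectors.Finite := by
  refine Set.Finite.of_finite_image (f := fun n => PointedCone.hull ℝ {toReal n})
    (S.finite.subset ?_) ?_
  · rintro _ ⟨n, hn, rfl⟩
    exact hn.2
  · intro n hn n' hn' h
    exact eq_of_hull_eq hn.1 hn'.1 h

instance (S : Fan N) : Fintype S.rayVectors := S.finite_rayVectors.fintype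

end Finiteness

end Fan

end Cones

/-! ### Closed subschemes of `Proj` cut out by homogeneous ideals -/

section GradedQuotient

variable {R : Type u} {A : Type v} [CommRing R] [CommRing A] [Algebra R A]
  (𝒜 : ℕ → Submodule R A) [GradedAlgebra 𝒜] (I : HomogeneousIdeal 𝒜)

/-- The grading of the quotient of a graded algebra by a homogeneous ideal. -/
def quotientGrading (k : ℕ) : Submodule R (A ⧸ I.toIdeal) :=
  (𝒜 k).map (Ideal.Quotient.mkₐ R I.toIdeal).toLinearMap

theorem mk_mem_quotientGrading {k : ℕ} {a : A} (ha : a ∈ 𝒜 k) :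
    Ideal.Quotient.mk I.toIdeal a ∈ quotientGrading 𝒜 I k :=
  ⟨a, ha, rfl⟩

instance quotientGradedMonoid : SetLike.GradedMonoid (quotientGrading 𝒜 I) where
  one_mem := mk_mem_quotientGrading 𝒜 I (SetLike.GradedOne.one_mem (A := 𝒜))
  mul_mem := by
    rintro i j _ _ ⟨a, ha, rfl⟩ ⟨c, hc, rfl⟩
    exact mk_mem_quotientGrading 𝒜 I (SetLike.GradedMul.mul_mem (A := 𝒜) ha hc)

/-- The homogeneous components of the class of an element. -/
def quotientComponents : A →+ ⨁ k, quotientGrading 𝒜 I k :=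
  (DirectSum.map fun k => (((Ideal.Quotient.mkₐ R I.toIdeal).toLinearMap.restrict
    (fun _ ha => mk_mem_quotientGrading 𝒜 I ha) :
      𝒜 k →ₗ[R] quotientGrading 𝒜 I k)).toAddMonoidHom).comp
    (DirectSum.decomposeAddEquiv 𝒜).toAddMonoidHom

theorem quotientComponents_apply (a : A) (k : ℕ) :
    (quotientComponents 𝒜 I a k : A ⧸ I.toIdeal) =
      Ideal.Quotient.mk I.toIdeal (DirectSum.decompose 𝒜 a k : A) := by
  simp only [quotientComponents, AddMonoidHom.comp_apply, DirectSum.map_apply]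
  rfl

theorem quotientComponents_coe {k : ℕ} (a : 𝒜 k) :
    quotientComponents 𝒜 I (a : A) =
      DirectSum.of (fun k => quotientGrading 𝒜 I k) k
        ⟨Ideal.Quotient.mk I.toIdeal (a : A), mk_mem_quotientGrading 𝒜 I a.2⟩ := by
  simp only [quotientComponents, AddMonoidHom.comp_apply]
  change DirectSum.map _ (DirectSum.decompose 𝒜 (a : A)) = _
  rw [DirectSum.decompose_coe, DirectSum.map_of]
  rfl

theorem quotientComponents_eq_zero {a : A} (ha : a ∈ I.toIdeal) : quotientComponents 𝒜 I a = 0 := by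
  ext k
  rw [quotientComponents_apply]
  exact Ideal.Quotient.eq_zero_iff_mem.mpr
    ((Ideal.IsHomogeneous.mem_iff 𝒜 (HomogeneousIdeal.isHomogeneous I)).mp ha k)

/-- The decomposition of an element of the quotient into its homogeneous components. -/
def quotientDecompose : (A ⧸ I.toIdeal) →+ ⨁ k, quotientGrading 𝒜 I k :=
  QuotientAddGroup.lift I.toIdeal.toAddSubgroup (quotientComponents 𝒜 I)
    fun _ ha => quotientComponents_eq_zero 𝒜 I ha

theorem quotientDecompose_mk (a : A) :
    quotientDecompose 𝒜 I (Ideal.Quotient.mk I.toIdeal a) = quotientComponents 𝒜 I a :=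
  rfl

instance quotientDecomposition : DirectSum.Decomposition (quotientGrading 𝒜 I) where
  decompose' := quotientDecompose 𝒜 I
  left_inv := by
    intro x
    obtain ⟨a, rfl⟩ := Ideal.Quotient.mk_surjective x
    rw [quotientDecompose_mk]
    induction a using DirectSum.Decomposition.inductionOn 𝒜 with
    | zero => simp
    | homogeneous m => rw [quotientComponents_coe, DirectSum.coeAddMonoidHom_of]
    | add m m' h h' => rw [map_add, map_add, h, h', map_add]
  right_inv := by
    intro y
    induction y using DirectSum.induction_on with
    | zero => simp
    | of k x =>
      obtain ⟨_, a, ha, rfl⟩ := x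
      rw [DirectSum.coeAddMonoidHom_of]
      exact quotientComponents_coe 𝒜 I ⟨a, ha⟩
    | add y z hy hz => rw [map_add, map_add, hy, hz]

instance quotientGradedAlgebra : GradedAlgebra (quotientGrading 𝒜 I) where

/-- The quotient map, as a homomorphism of graded rings. -/
def quotientGradedHom : GradedRingHom 𝒜 (quotientGrading 𝒜 I) where
  toRingHom := Ideal.Quotient.mk I.toIdeal
  map_mem := fun ha => mk_mem_quotientGrading 𝒜 I ha

theorem quotientGradedHom_mem {k : ℕ} {a : A} (ha : a ∈ 𝒜 k) :
    quotientGradedHom 𝒜 I a ∈ quotientGrading 𝒜 I k :=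
  mk_mem_quotientGrading 𝒜 I ha

theorem irrelevant_le_map :
    HomogeneousIdeal.irrelevant (quotientGrading 𝒜 I) ≤
      (HomogeneousIdeal.irrelevant 𝒜).map (quotientGradedHom 𝒜 I) := by
  rw [← toIdeal_le_toIdeal_iff, HomogeneousIdeal.toIdeal_irrelevant_le]
  rintro i hi _ ⟨a, ha, rfl⟩
  exact Ideal.mem_map_of_mem _ (HomogeneousIdeal.mem_irrelevant_of_mem 𝒜 hi ha)

/-- The canonical morphism `Proj (A / I) ⟶ Proj A`. -/
def projQuotientι : Proj (quotientGrading 𝒜 I) ⟶ Proj 𝒜 :=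
  Proj.map (quotientGradedHom 𝒜 I) (irrelevant_le_map 𝒜 I)

theorem awayMap_surjective {k : ℕ} {s : A} (hs : s ∈ 𝒜 k) :
    Function.Surjective (HomogeneousLocalization.Away.map (quotientGradedHom 𝒜 I) s) := by
  intro x
  obtain ⟨n, y, hy, rfl⟩ := x.mk_surjective _ (quotientGradedHom_mem 𝒜 I hs)
  obtain ⟨a, ha, rfl⟩ := hy
  exact ⟨.mk 𝒜 hs n a ha, HomogeneousLocalization.Away.map_mk _ _ _ _ _ _⟩

theorem isPullback_awayι {k : ℕ} (hk : 0 < k) {s : A} (hs : s ∈ 𝒜 k) :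
    CategoryTheory.IsPullback
      (Spec.map (CommRingCat.ofHom
        (HomogeneousLocalization.Away.map (quotientGradedHom 𝒜 I) s)))
      (Proj.awayι (quotientGrading 𝒜 I) (quotientGradedHom 𝒜 I s)
        (quotientGradedHom_mem 𝒜 I hs) hk)
      (Proj.awayι 𝒜 s hs hk) (projQuotientι 𝒜 I) := by
  apply IsOpenImmersion.isPullback
  · exact Proj.awayι_comp_map _ _ hk s hs
  · rw [Proj.opensRange_awayι, Proj.opensRange_awayι]
    rfl

/-- `Proj (A / I)` is a closed subscheme of `Proj A`. -/
instance isClosedImmersion_projQuotientι : IsClosedImmersion (projQuotientι 𝒜 I) := by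
  have key : ∀ {k : ℕ} (hk : 0 < k) {s : A} (hs : s ∈ 𝒜 k), IsClosedImmersion
      (CategoryTheory.Limits.pullback.snd (projQuotientι 𝒜 I) (Proj.awayι 𝒜 s hs hk)) := by
    intro k hk s hs
    have h1 := IsClosedImmersion.spec_of_surjective (CommRingCat.ofHom
      (HomogeneousLocalization.Away.map (quotientGradedHom 𝒜 I) s)) (awayMap_surjective 𝒜 I hs)
    rw [← (isPullback_awayι 𝒜 I hk hs).flip.isoPullback_inv_snd]
    infer_instance
  rw [IsZariskiLocalAtTarget.iff_of_openCover (P := @IsClosedImmersion)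
    (Proj.affineOpenCover 𝒜).openCover]
  exact fun i => key i.1.2 i.2.2

end GradedQuotient

/-- The structure morphism of rings `R → Γ(Proj 𝒜, 𝒪)` for a graded `R`-algebra. -/
def projAlgebraMap {R : Type u} {A : Type v} [CommRing R] [CommRing A] [Algebra R A]
    (𝒜 : ℕ → Submodule R A) [GradedAlgebra 𝒜] : R →+* Γ(Proj 𝒜, ⊤) :=
  ((Proj.toSpecZero 𝒜).appTop.hom.comp (Scheme.ΓSpecIso (.of (𝒜 0))).inv.hom).comp
    (algebraMap R (𝒜 0))

/-! ### Laurent polynomials, log-derivatives, the superpotential -/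

/-- For an additive map `φ : G → ℤ`, the `K`-linear operator of `K[G]` with
`x^g ↦ φ(g) x^g`. For `G = N` and `φ = m ∈ M = Hom(N, ℤ)` this is the log-derivative `∂_m`. -/
def logDeriv (K : Type u) [Field K] {G : Type v} [AddCommMonoid G] (φ : G →+ ℤ) :
    AddMonoidAlgebra K G →ₗ[K] AddMonoidAlgebra K G :=
  (Finsupp.lsum K fun g => (φ g : K) • AddMonoidAlgebra.lsingle g) ∘ₗ
    (AddMonoidAlgebra.coeffLinearEquiv K).toLinearMap

theorem logDeriv_single (K : Type u) [Field K] {G : Type v} [AddCommMonoid G] (φ : G →+ ℤ)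
    (g : G) (a : K) :
    logDeriv K φ (AddMonoidAlgebra.single g a) = AddMonoidAlgebra.single g ((φ g : K) * a) := by
  simp [logDeriv, AddMonoidAlgebra.coeffLinearEquiv]

section Critical

variable {K : Type u} [Field K] {N : Type v} [AddCommGroup N]

/-- The Jacobian ideal `J_f ⊆ K[N]`, generated by all log-derivatives `∂_m f`, `m ∈ M`. -/
def jacobianIdeal (f : AddMonoidAlgebra K N) : Ideal (AddMonoidAlgebra K N) :=
  Ideal.span (Set.range fun m : Module.Dual ℤ N => logDeriv K m.toAddMonoidHom f)

/-- The value `f(p)`, in the residue field of `p`, of a function `f` at a point `p` of the torus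
`T_M = Spec K[N]`. -/
def valueAt (p : PrimeSpectrum (AddMonoidAlgebra K N)) (f : AddMonoidAlgebra K N) :
    p.asIdeal.ResidueField :=
  algebraMap (AddMonoidAlgebra K N) p.asIdeal.ResidueField f

/-- `p` is a critical point of `f`: all log-derivatives vanish at `p`. The log-derivatives `∂_m`
for `m` in a basis of `M` are a frame of the tangent bundle of the torus, so this says that the
differential of `f` vanishes at `p`. -/
def IsCriticalPoint (f : AddMonoidAlgebra K N) (p : PrimeSpectrum (AddMonoidAlgebra K N)) : Prop :=
  ∀ m : Module.Dual ℤ N, valueAt p (logDeriv K m.toAddMonoidHom f) = 0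

/-- The matrix `(∂_i ∂_j f)(p)` of the second log-derivatives with respect to a basis of
`M = Hom(N, ℤ)`. At a critical point `p` of `f` this is the matrix of the Hessian form of `f` on
the tangent space at `p`, in the basis given by the vector fields `∂_i`. -/
def hessian [Module.Free ℤ N] [Module.Finite ℤ N] (f : AddMonoidAlgebra K N)
    (p : PrimeSpectrum (AddMonoidAlgebra K N)) :
    Matrix (Module.Free.ChooseBasisIndex ℤ (Module.Dual ℤ N))
      (Module.Free.ChooseBasisIndex ℤ (Module.Dual ℤ N)) p.asIdeal.ResidueField :=
  Matrix.of fun i j =>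
    let e := Module.Free.chooseBasis ℤ (Module.Dual ℤ N)
    valueAt p (logDeriv K (e i).toAddMonoidHom (logDeriv K (e j).toAddMonoidHom f))

/-- The Hessian of `f` at `p` is non-degenerate (used for critical points `p`). -/
def IsNondegenerateAt [Module.Free ℤ N] [Module.Finite ℤ N] (f : AddMonoidAlgebra K N)
    (p : PrimeSpectrum (AddMonoidAlgebra K N)) : Prop :=
  (hessian f p).det ≠ 0

end Critical

namespace Fan

variable {K : Type u} [Field K] {N : Type v} [AddCommGroup N]

variable (K) in
/-- The homogeneous coordinate ring `⨁_k Span {x^n t^k | n ∈ k Δ* ∩ N}` of the polarized toric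
variety of the polytope `Δ*`; it is the section ring `⨁_k H⁰(X*, 𝒪(-k K_{X*}))`. -/
abbrev sectionRing (S : Fan N) : Type max u v := AddMonoidAlgebra K S.coneSemigroup

variable (K) in
/-- The grading of the section ring by the power of `t`. -/
abbrev sectionGrading (S : Fan N) : ℕ → Submodule K (S.sectionRing K) :=
  AddMonoidAlgebra.gradeBy K S.degree

variable (K) in
/-- The dual toric Fano variety `X*`: the projective toric variety of the polytope `Δ*`. Its sheaf
`𝒪(1)` is `𝒪(-K_{X*})`, and its open subset where the section `x^0 t` of `𝒪(1)` does not vanish is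
the torus `T_M = Spec K[N]`. -/
def dualVariety (S : Fan N) : Scheme.{max u v} := Proj (S.sectionGrading K)

variable [Module.Free ℤ N] [Module.Finite ℤ N]

/-- The Laurent polynomial `W = ∑_ρ b_ρ x^{n_ρ}`, a function on the torus `T_M = Spec K[N]`. -/
def potential (S : Fan N) (b : S.rayVectors → K) : AddMonoidAlgebra K N :=
  ∑ ρ, AddMonoidAlgebra.single ρ.1 (b ρ)

/-- `W` as a section of the anticanonical bundle `𝒪(1) = 𝒪(-K_{X*})`, that is, as the element
`∑_ρ b_ρ x^{n_ρ} t` of degree one of the section ring. -/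
def potentialSection (S : Fan N) (b : S.rayVectors → K) : S.sectionRing K :=
  ∑ ρ, AddMonoidAlgebra.single ⟨(ρ.1, 1), S.ray_mem_coneSemigroup ρ⟩ (b ρ)

/-- The log-derivative `∂_m W` as a section of the anticanonical bundle of `X*`. -/
def logDerivSection (S : Fan N) (b : S.rayVectors → K) (m : Module.Dual ℤ N) : S.sectionRing K :=
  logDeriv K (m.toAddMonoidHom.comp S.lattice) (S.potentialSection b)

theorem logDerivSection_mem (S : Fan N) (b : S.rayVectors → K) (m : Module.Dual ℤ N) :
    S.logDerivSection b m ∈ S.sectionGrading K 1 := by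
  rw [logDerivSection, potentialSection, map_sum]
  refine Submodule.sum_mem _ fun ρ _ => ?_
  rw [logDeriv_single]
  exact AddMonoidAlgebra.single_mem_gradeBy S.degree
    (⟨(ρ.1, 1), S.ray_mem_coneSemigroup ρ⟩ : S.coneSemigroup) _

/-- The homogeneous ideal of the section ring generated by the sections `∂_m W`, `m ∈ M`. -/
def logDerivIdeal (S : Fan N) (b : S.rayVectors → K) : HomogeneousIdeal (S.sectionGrading K) where
  toSubmodule := Ideal.span (Set.range (S.logDerivSection b))
  is_homogeneous' := Ideal.homogeneous_span _ _ (by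
    rintro _ ⟨m, rfl⟩
    exact ⟨1, S.logDerivSection_mem b m⟩)

/-- The closed subscheme `Z_W ⊆ X*` whose ideal sheaf `𝒥_W` is such that
`𝒥_W(-K_{X*}) ⊆ 𝒪(-K_{X*})` is generated by the log-derivatives `∂_m W`: the closed subscheme of
`X* = Proj` cut out by the homogeneous ideal which these sections of `𝒪(1)` generate, i.e. the
`Proj` of the quotient ring. -/
def criticalScheme (S : Fan N) (b : S.rayVectors → K) : Scheme.{max u v} :=
  Proj (quotientGrading (S.sectionGrading K) (S.logDerivIdeal b))

/-- The closed immersion of `Z_W` into `X*`. -/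
def criticalSchemeι (S : Fan N) (b : S.rayVectors → K) : S.criticalScheme b ⟶ S.dualVariety K :=
  projQuotientι (S.sectionGrading K) (S.logDerivIdeal b)

instance (S : Fan N) (b : S.rayVectors → K) : IsClosedImmersion (S.criticalSchemeι b) :=
  isClosedImmersion_projQuotientι (S.sectionGrading K) (S.logDerivIdeal b)

/-- The ring `𝒪(Z_W)` of global functions on `Z_W`. -/
abbrev criticalFunctions (S : Fan N) (b : S.rayVectors → K) : Type max u v :=
  Γ(S.criticalScheme b, ⊤)

instance (S : Fan N) (b : S.rayVectors → K) : Algebra K (S.criticalFunctions b) :=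
  (projAlgebraMap (quotientGrading (S.sectionGrading K) (S.logDerivIdeal b))).toAlgebra

end Fan

/-! ### Semisimple algebras, and algebras with a field as a direct summand -/

/-- A finite dimensional commutative algebra over a field is semisimple if it contains no non-zero
nilpotent elements. -/
def IsSemisimpleAlgebra (K : Type u) (A : Type v) [Field K] [CommRing A] [Algebra K A] : Prop :=
  Module.Finite K A ∧ ∀ a : A, IsNilpotent a → a = 0

/-- The `K`-algebra `A` decomposes as a direct sum `L ⊕ A'` of algebras, where `L / K` is a field
extension. -/
def ContainsFieldAsDirectSummand (K : Type u) (A : Type v) [Field K] [CommRing A] [Algebra K A] :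
    Prop :=
  ∃ (L A' : Type v) (_ : Field L) (_ : CommRing A') (_ : Algebra K L) (_ : Algebra K A'),
    Nonempty (A ≃ₐ[K] L × A')

end ToricFano

end

/-! The Fano condition provides a concave support function `F`, linear on each cone, with value -1
on the ray vectors. By smoothness a lattice point of a cone is a sum of its ray vectors, and `-F`
counts the summands. Hence the cone over `Δ*` is generated by `(0, 1)` and the `(n_ρ, 1)`
(`coneSemigroup_eq_closure`), and the section ring by `t = x^0 t` and the `x^{n_ρ} t`.

The geometric point is that `Z_W` misses the boundary `t = 0` of `X*` (`raySection_mem_of_isPrime`).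
Let a prime contain `t` and all `∂_m W`. The rays whose sections lie outside it span a common cone:
otherwise strict convexity makes the product of these sections divisible by `t`. Their vectors are
then part of a basis of `N`, and the dual basis vector `m` of one of them reduces `∂_m W` to the
single term `b_ρ x^{n_ρ} t`, which must lie in the prime. So every section of positive degree lies
in it, which no point of `Proj` allows. Thus `Z_W` is contained in the torus and equals `Spec
K[N]/J_W`; being both proper and affine, it is finite over `K`.

What remains is local algebra on the Artinian ring `K[N]/J_W`. Its differentials are generated by
the forms `dlog x^{ν_i}`, with the Hessian giving relations among them, so an invertible Hessian
makes a local ring unramified, hence reduced, hence a field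
(`formallyUnramified_of_isUnit_hessian`). Conversely, at a reduced point a null vector of the
Hessian would give a non-zero `K`-derivation on the residue field, which is separable over the
perfect field `K` (`hessian_notMem_of_forall_exists_mul_mem`). Reduced local rings at all points
mean semisimplicity; at one point, a field summand. -/

noncomputable section

namespace ToricFano

universe u v

/-! ### Separation theorems for cones and concave functions. -/

section ConvexGeometry

variable {V : Type*} [AddCommGroup V] [Module ℝ V]

/-- Gordan's alternative. -/
theorem exists_dual_pos_of_zero_notMem_convexHull [FiniteDimensional ℝ V] {s : Set V}
    (hs : s.Finite) (h : (0 : V) ∉ convexHull ℝ s) :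
    ∃ m : Module.Dual ℝ V, ∀ v ∈ s, 0 < m v := by
  let e := (Module.finBasis ℝ V).equivFun
  have h0 : (0 : Fin (Module.finrank ℝ V) → ℝ) ∉ convexHull ℝ (e '' s) := by
    rw [← LinearEquiv.coe_coe, ← LinearMap.image_convexHull]
    rintro ⟨x, hx, hx0⟩
    have : x = 0 := by simpa using hx0
    exact h (this ▸ hx)
  obtain ⟨f, u, hu, hf⟩ := geometric_hahn_banach_point_closed (convex_convexHull ℝ _)
    ((hs.image e).isClosed_convexHull (𝕜 := ℝ)) h0
  refine ⟨f.toLinearMap.comp e.toLinearMap, fun v hv => ?_⟩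
  have h1 := hf (e v) (subset_convexHull ℝ _ ⟨v, hv, rfl⟩)
  rw [map_zero] at hu
  exact hu.trans h1

/-- The non-zero vectors of a salient cone form a convex set, so this set contains the convex hull
of `s`. -/
theorem zero_notMem_convexHull {s : Set V} (h0 : (0 : V) ∉ s)
    (hsal : ∀ x ∈ PointedCone.hull ℝ s, -x ∈ PointedCone.hull ℝ s → x = 0) :
    (0 : V) ∉ convexHull ℝ s := by
  have hconv : Convex ℝ {x | x ∈ PointedCone.hull ℝ s ∧ x ≠ 0} := by
    rintro x ⟨hx, hx0⟩ y ⟨hy, hy0⟩ a c ha hc hac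
    have hax := PointedCone.smul_mem _ ha hx
    have hcy := PointedCone.smul_mem _ hc hy
    refine ⟨add_mem hax hcy, fun h => ?_⟩
    have h1 : a • x = 0 := hsal _ hax (by rwa [neg_eq_of_add_eq_zero_right h])
    have h2 : c • y = 0 := by simpa [h1] using h
    rcases smul_eq_zero.mp h1 with h1 | h1
    · rcases smul_eq_zero.mp h2 with h2 | h2
      · linarith
      · exact hy0 h2
    · exact hx0 h1
  intro h
  have hsub : s ⊆ {x | x ∈ PointedCone.hull ℝ s ∧ x ≠ 0} :=
    fun x hx => ⟨PointedCone.subset_hull hx, fun h' => h0 (h' ▸ hx)⟩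
  exact (convexHull_min hsub hconv h).2 rfl

/-- A vector of a salient cone that is not spanned by the other generators is exposed. -/
theorem exists_dual_exposing [FiniteDimensional ℝ V] {s : Set V} {v : V} (hs : s.Finite)
    (h0 : (0 : V) ∉ s) (hv : v ∉ PointedCone.hull ℝ s)
    (hsal : ∀ x ∈ PointedCone.hull ℝ (insert v s), -x ∈ PointedCone.hull ℝ (insert v s) → x = 0) :
    ∃ m : Module.Dual ℝ V, m v = 0 ∧ ∀ w ∈ s, 0 < m w := by
  have hmono : PointedCone.hull ℝ s ≤ PointedCone.hull ℝ (insert v s) :=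
    Submodule.span_mono (Set.subset_insert v s)
  have hvm : v ∈ PointedCone.hull ℝ (insert v s) := PointedCone.subset_hull (Set.mem_insert v s)
  have hcs : convexHull ℝ s ⊆ PointedCone.hull ℝ s :=
    convexHull_min PointedCone.subset_hull (PointedCone.convex _)
  -- Functionals vanishing on `v` are those of the quotient by the line of `v`, where Gordan's
  -- alternative applies unless some multiple `c • v` lies in the convex hull of `s`.
  let p := (Submodule.span ℝ {v}).mkQ
  have hp : (0 : V ⧸ Submodule.span ℝ {v}) ∉ convexHull ℝ (p '' s) := by
    rw [← LinearMap.image_convexHull]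
    rintro ⟨y, hy, hy0⟩
    obtain ⟨c, rfl⟩ := Submodule.mem_span_singleton.mp
      ((Submodule.Quotient.mk_eq_zero _).mp hy0)
    have hys := hcs hy
    -- If `c > 0`, then `v` is in the cone of `s`. If `c ≤ 0`, then `c • v` and its negative lie in
    -- the salient cone, so `0` is in the convex hull of `s`.
    rcases lt_or_ge 0 c with hc | hc
    · apply hv
      have := PointedCone.smul_mem _ (inv_nonneg.mpr hc.le) hys
      rwa [inv_smul_smul₀ hc.ne'] at this
    · have hz : c • v = 0 := hsal _ (hmono hys) (by
        rw [← neg_smul]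
        exact PointedCone.smul_mem _ (by linarith) hvm)
      rw [hz] at hy
      exact zero_notMem_convexHull h0
        (fun x hx hx' => hsal x (hmono hx) (hmono hx')) hy
  obtain ⟨m, hm⟩ := exists_dual_pos_of_zero_notMem_convexHull (hs.image p) hp
  refine ⟨m.comp p, ?_, fun w hw => hm _ ⟨w, hw, rfl⟩⟩
  have : p v = 0 := (Submodule.Quotient.mk_eq_zero _).mpr (Submodule.mem_span_singleton_self v)
  simp [this]

theorem eq_zero_of_mem_hull_of_pos {s : Set V} {m : Module.Dual ℝ V} (hm : ∀ w ∈ s, 0 < m w)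
    {x : V} (hx : x ∈ PointedCone.hull ℝ s) : 0 ≤ m x ∧ (m x = 0 → x = 0) := by
  induction hx using Submodule.span_induction with
  | mem x h => exact ⟨(hm x h).le, fun h' => absurd h' (hm x h).ne'⟩
  | zero => simp
  | add x y _ _ hx hy =>
    rw [map_add]
    refine ⟨add_nonneg hx.1 hy.1, fun h => ?_⟩
    rw [hx.2 (by linarith [hx.1, hy.1]), hy.2 (by linarith [hx.1, hy.1]), add_zero]
  | smul a x _ hx =>
    have h1 : m (a • x) = (a : ℝ) * m x := by
      change m ((a : ℝ) • x) = _
      rw [map_smul, smul_eq_mul]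
    rw [h1]
    refine ⟨mul_nonneg a.2 hx.1, fun h => ?_⟩
    rcases mul_eq_zero.mp h with h | h
    · have : a = 0 := Subtype.ext h
      rw [this, zero_smul]
    · rw [hx.2 h, smul_zero]

/-- A form of the Hahn-Banach theorem: a positively homogeneous superadditive function is
touched from above by a linear function at every point. -/
theorem exists_dual_ge_eq {F : V → ℝ} (hhom : ∀ c : ℝ, 0 < c → ∀ x, F (c • x) = c * F x)
    (hadd : ∀ x y, F x + F y ≤ F (x + y)) (x : V) :
    ∃ m : Module.Dual ℝ V, (∀ y, F y ≤ m y) ∧ m x = F x := by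
  have hF0 : F 0 = 0 := by
    have := hhom 2 two_pos 0
    rw [smul_zero] at this
    linarith
  rcases eq_or_ne x 0 with rfl | hx
  · obtain ⟨g, -, hg⟩ := exists_extension_of_le_sublinear (⟨⊥, 0⟩ : V →ₗ.[ℝ] ℝ) (fun y => -F y)
      (fun c hc y => by rw [hhom c hc]; ring) (fun y z => by linarith [hadd y z]) (by
        rintro ⟨y, hy⟩
        obtain rfl : y = 0 := by simpa using hy
        simp [hF0])
    exact ⟨-g, fun y => by have := hg y; simp only [LinearMap.neg_apply]; linarith, by simp [hF0]⟩
  · obtain ⟨g, hgx, hg⟩ := exists_extension_of_le_sublinear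
      (LinearPMap.mkSpanSingleton (K := ℝ) x (-F x) hx) (fun y => -F y)
      (fun c hc y => by rw [hhom c hc]; ring) (fun y z => by linarith [hadd y z]) (by
        rintro ⟨y, hy⟩
        obtain ⟨c, rfl⟩ := Submodule.mem_span_singleton.mp hy
        erw [LinearPMap.mkSpanSingleton'_apply]
        simp only [smul_eq_mul, RingHom.id_apply]
        rcases lt_trichotomy c 0 with hc | rfl | hc
        -- For `c < 0`, superadditivity at `c • x` and `-c • x` gives `F (c • x) ≤ c * F x`.
        · have h1 := hhom (-c) (by linarith) x
          have h2 := hadd (c • x) (-c • x)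
          rw [← add_smul, add_neg_cancel, zero_smul, hF0] at h2
          rw [h1] at h2
          linarith
        · simp [hF0]
        · rw [hhom c hc]; linarith)
    refine ⟨-g, fun y => by have := hg y; simp only [LinearMap.neg_apply]; linarith, ?_⟩
    have h1 := hgx ⟨x, Submodule.mem_span_singleton_self x⟩
    have h2 := LinearPMap.mkSpanSingleton_apply ℝ ℝ (σ := RingHom.id ℝ) hx (-F x)
    rw [h2] at h1
    simp only at h1
    rw [LinearMap.neg_apply, h1, neg_neg]

end ConvexGeometry

/-! ### Lattice points and generators of the cones of a fan. -/

section LatticeLemmas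

variable {N : Type v} [AddCommGroup N]

@[simp] theorem toReal_zero : toReal (0 : N) = 0 := TensorProduct.tmul_zero _ _

theorem toReal_add (x y : N) : toReal (x + y) = toReal x + toReal y :=
  TensorProduct.tmul_add _ _ _

theorem toReal_zsmul (k : ℤ) (x : N) : toReal (k • x) = (k : ℝ) • toReal x := by
  rw [toReal, TensorProduct.tmul_smul, ← Int.cast_smul_eq_zsmul ℝ]
  rfl

theorem toReal_nsmul (k : ℕ) (x : N) : toReal (k • x) = (k : ℝ) • toReal x := by
  rw [← natCast_zsmul, toReal_zsmul, Int.cast_natCast]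

theorem toReal_sum {ι : Type*} (s : Finset ι) (f : ι → N) :
    toReal (∑ i ∈ s, f i) = ∑ i ∈ s, toReal (f i) :=
  TensorProduct.tmul_sum _ _ _

theorem baseChange_repr_toReal {ι : Type*} (e : Module.Basis ι ℤ N) (n : N) (i : ι) :
    (e.baseChange ℝ).repr (toReal n) i = (e.repr n i : ℝ) := by
  simp [toReal, Module.Basis.baseChange_repr_tmul]

variable [Module.Free ℤ N] [Module.Finite ℤ N]

/-- Every non-zero lattice vector is a positive multiple of a primitive one. -/
theorem exists_isPrimitive_smul {n : N} (hn : n ≠ 0) :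
    ∃ (k : ℕ) (n' : N), 0 < k ∧ IsPrimitive n' ∧ n = k • n' := by
  let e := Module.Free.chooseBasis ℤ N
  obtain ⟨i, hi⟩ : ∃ i, e.repr n i ≠ 0 := by
    by_contra! hcon
    exact hn (e.repr.map_eq_zero_iff.mp (Finsupp.ext hcon))
  -- Dividing by a non-unit shrinks the absolute value of a fixed non-zero coordinate, so the
  -- descent terminates.
  induction hd : (e.repr n i).natAbs using Nat.strong_induction_on generalizing n with
  | _ d ih =>
    by_cases hp : IsPrimitive n
    · exact ⟨1, n, one_pos, hp, (one_smul _ _).symm⟩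
    · simp only [IsPrimitive, not_forall] at hp
      obtain ⟨j, w, rfl, hj⟩ := hp
      have hc : e.repr (j • w) i = j * e.repr w i := by simp
      have hw : e.repr w i ≠ 0 := fun h => hi (by rw [hc, h, mul_zero])
      have hj0 : j ≠ 0 := fun h => hi (by rw [hc, h, zero_mul])
      have hj1 : 1 < j.natAbs := by
        have h1 : j.natAbs ≠ 1 := fun h => hj (Int.isUnit_iff_natAbs_eq.mpr h)
        have h2 : j.natAbs ≠ 0 := Int.natAbs_ne_zero.mpr hj0
        omega
      obtain ⟨w', hw', hsign⟩ : ∃ w' : N, (e.repr w' i).natAbs = (e.repr w i).natAbs ∧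
          j • w = j.natAbs • w' := by
        rcases Int.natAbs_eq j with h | h
        · exact ⟨w, rfl, by nth_rewrite 1 [h]; rw [natCast_zsmul]⟩
        · exact ⟨-w, by simp, by nth_rewrite 1 [h]; rw [neg_smul, natCast_zsmul, smul_neg]⟩
      have hw'0 : e.repr w' i ≠ 0 := by
        rw [← Int.natAbs_ne_zero, hw', Int.natAbs_ne_zero]; exact hw
      have hlt : (e.repr w' i).natAbs < d := by
        rw [← hd, hc, Int.natAbs_mul, hw']
        have := Int.natAbs_pos.mpr hw
        nlinarith
      have hw'n : w' ≠ 0 := by rintro rfl; simp at hw'0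
      obtain ⟨k, n', hk, hn', h⟩ := ih _ hlt hw'n hw'0 rfl
      exact ⟨j.natAbs * k, n', by positivity, hn', by rw [hsign, h, mul_smul]⟩

namespace Fan

/-- Every cone of the fan is spanned by its rays. -/
theorem le_hull_rayVectors (S : Fan N) {σ : PointedCone ℝ (RealSpace N)} (hσ : σ ∈ S.cones) :
    σ ≤ PointedCone.hull ℝ (toReal '' {n | n ∈ S.rayVectors ∧ toReal n ∈ σ}) := by
  classical
  -- In a generating set of least cardinality no generator lies in the cone of the others, so each
  -- one is exposed and spans a face.
  obtain ⟨t, ht, htmin⟩ : ∃ t : Finset N, σ = PointedCone.hull ℝ (toReal '' (t : Set N)) ∧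
      ∀ t' : Finset N, σ = PointedCone.hull ℝ (toReal '' (t' : Set N)) → t.card ≤ t'.card := by
    obtain ⟨t, ht, hmin⟩ := exists_minimalFor_of_wellFoundedLT
      (fun t : Finset N => σ = PointedCone.hull ℝ (toReal '' (t : Set N))) Finset.card
      (S.rational σ hσ)
    exact ⟨t, ht, fun t' ht' => (le_total t.card t'.card).elim id (hmin ht')⟩
  have hins : ∀ n ∈ t, toReal '' (t : Set N) =
      insert (toReal n) (toReal '' ((t.erase n : Finset N) : Set N)) := by
    intro n hn
    rw [← Set.image_insert_eq, ← Finset.coe_insert, Finset.insert_erase hn]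
  have hnot : ∀ n ∈ t, toReal n ∉
      PointedCone.hull ℝ (toReal '' ((t.erase n : Finset N) : Set N)) := by
    intro n hn hmem
    have h := htmin (t.erase n) (by
      rw [ht, hins n hn]
      exact Submodule.span_insert_eq_span hmem)
    have := Finset.card_erase_lt_of_mem hn
    omega
  have hne : ∀ n ∈ t, toReal n ≠ 0 := fun n hn h => hnot n hn (h ▸ zero_mem _)
  nth_rewrite 1 [ht]
  refine Submodule.span_le.mpr ?_
  rintro _ ⟨n, hn, rfl⟩
  have hsal : ∀ x ∈ PointedCone.hull ℝ (insert (toReal n)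
      (toReal '' ((t.erase n : Finset N) : Set N))), -x ∈ PointedCone.hull ℝ (insert (toReal n)
      (toReal '' ((t.erase n : Finset N) : Set N))) → x = 0 := by
    rw [← hins n hn, ← ht]
    exact S.strictlyConvex σ hσ
  obtain ⟨m, hmn, hm⟩ := exists_dual_exposing ((Finset.finite_toSet _).image _) (by
    rintro ⟨w, hw, hw0⟩
    exact hne w (Finset.mem_of_mem_erase hw) hw0) (hnot n hn) hsal
  have hmem : ∀ x, x ∈ σ ↔ ∃ a : NNReal, ∃ z ∈ PointedCone.hull ℝ
      (toReal '' ((t.erase n : Finset N) : Set N)), x = a • toReal n + z := by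
    intro x
    rw [ht, hins n hn]
    exact Submodule.mem_span_insert
  have hmx : ∀ (a : NNReal) z, m (a • toReal n + z) = m z := by
    intro a z
    rw [map_add]
    change m ((a : ℝ) • toReal n) + m z = _
    rw [map_smul, hmn, smul_zero, zero_add]
  have hface : IsFace (PointedCone.hull ℝ {toReal n}) σ := by
    refine ⟨m, fun x hx => ?_, fun x => ⟨fun hx => ?_, fun ⟨hx, hx0⟩ => ?_⟩⟩
    · obtain ⟨a, z, hz, rfl⟩ := (hmem x).mp hx
      rw [hmx]
      exact (eq_zero_of_mem_hull_of_pos hm hz).1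
    · obtain ⟨a, rfl⟩ := Submodule.mem_span_singleton.mp hx
      refine ⟨(hmem _).mpr ⟨a, 0, zero_mem _, (add_zero _).symm⟩, ?_⟩
      have h := hmx a 0
      rw [add_zero, map_zero] at h
      exact h
    · obtain ⟨a, z, hz, rfl⟩ := (hmem x).mp hx
      rw [hmx] at hx0
      rw [(eq_zero_of_mem_hull_of_pos hm hz).2 hx0, add_zero]
      exact Submodule.mem_span_singleton.mpr ⟨a, rfl⟩
  have hn0 : n ≠ 0 := fun h => hne n hn (by rw [h, toReal_zero])
  -- The generator need not be primitive; the primitive vector on the same ray is the ray vector of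
  -- the fan.
  obtain ⟨k, n', hk, hn', hnk⟩ := exists_isPrimitive_smul hn0
  have hk' : (0 : ℝ) < k := by exact_mod_cast hk
  have h1 : toReal n = (k : ℝ) • toReal n' := by rw [hnk, toReal_nsmul]
  have h2 : toReal n' = (k : ℝ)⁻¹ • toReal n := by rw [h1, inv_smul_smul₀ hk'.ne']
  have h3 : PointedCone.hull ℝ {toReal n} = PointedCone.hull ℝ {toReal n'} := by
    apply le_antisymm <;> rw [PointedCone.hull, Submodule.span_singleton_le_iff_mem]
    · rw [h1]
      exact PointedCone.smul_mem _ hk'.le (PointedCone.subset_hull rfl)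
    · rw [h2]
      exact PointedCone.smul_mem _ (inv_nonneg.mpr hk'.le) (PointedCone.subset_hull rfl)
  have h4 : toReal n' ∈ σ := by
    rw [h2]
    refine PointedCone.smul_mem _ (inv_nonneg.mpr hk'.le) ?_
    rw [ht]
    exact PointedCone.subset_hull ⟨n, hn, rfl⟩
  change toReal n ∈ PointedCone.hull ℝ _
  rw [h1]
  exact PointedCone.smul_mem _ hk'.le
    (PointedCone.subset_hull ⟨n', ⟨⟨hn', h3 ▸ S.face_mem σ hσ _ hface⟩, h4⟩, rfl⟩)

/-- The lattice points of a cone of a smooth fan are generated by the primitive vectors of its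
rays. -/
theorem mem_closure_of_mem_cone (S : Fan N) (hS : S.IsSmooth) {σ : PointedCone ℝ (RealSpace N)}
    (hσ : σ ∈ S.cones) {n : N} (hn : toReal n ∈ σ) :
    n ∈ AddSubmonoid.closure {n | n ∈ S.rayVectors ∧ toReal n ∈ σ} := by
  obtain ⟨e, he⟩ := hS σ hσ
  -- In a basis extending the ray vectors of `σ`, points of the cone have non-negative coordinates
  -- supported on those vectors. For a lattice point they are natural numbers.
  have key : ∀ x ∈ PointedCone.hull ℝ (toReal '' {n | n ∈ S.rayVectors ∧ toReal n ∈ σ}), ∀ i,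
      0 ≤ (e.baseChange ℝ).repr x i ∧ ((e.baseChange ℝ).repr x i ≠ 0 →
        e i ∈ S.rayVectors ∧ toReal (e i) ∈ σ) := by
    intro x hx i
    induction hx using Submodule.span_induction with
    | mem x h =>
      obtain ⟨n, hn, rfl⟩ := h
      obtain ⟨j, rfl⟩ := he n hn.1 hn.2
      rw [baseChange_repr_toReal, e.repr_self, Finsupp.single_apply]
      split_ifs with h
      · subst h
        exact ⟨by simp, fun _ => hn⟩
      · simp
    | zero => simp
    | add x y _ _ hx hy =>
      rw [map_add, Finsupp.add_apply]
      refine ⟨add_nonneg hx.1 hy.1, fun h => ?_⟩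
      by_cases hx0 : (e.baseChange ℝ).repr x i = 0
      · exact hy.2 fun hy0 => h (by rw [hx0, hy0, add_zero])
      · exact hx.2 hx0
    | smul a x _ hx =>
      have h1 : (e.baseChange ℝ).repr (a • x) i = (a : ℝ) * (e.baseChange ℝ).repr x i := by
        change (e.baseChange ℝ).repr ((a : ℝ) • x) i = _
        rw [map_smul, Finsupp.smul_apply, smul_eq_mul]
      rw [h1]
      exact ⟨mul_nonneg a.2 hx.1, fun h => hx.2 (right_ne_zero_of_mul h)⟩
  rw [← e.sum_repr n]
  refine sum_mem fun i _ => ?_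
  have h := key _ (S.le_hull_rayVectors hσ hn) i
  rw [baseChange_repr_toReal] at h
  have h0 : 0 ≤ e.repr n i := by exact_mod_cast h.1
  by_cases hz : e.repr n i = 0
  · rw [hz, zero_smul]; exact zero_mem _
  · obtain ⟨a, ha⟩ := Int.eq_ofNat_of_zero_le h0
    rw [ha, natCast_zsmul]
    refine AddSubmonoid.nsmul_mem _ (AddSubmonoid.subset_closure ?_) _
    exact h.2 (by exact_mod_cast hz)

end Fan

end LatticeLemmas

/-! ### The support function and the semigroup of the cone over `Δ*`. -/

namespace Fan

variable {N : Type v} [AddCommGroup N]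

/-- The support function of a Fano fan, with the properties used below. -/
theorem IsFano.exists_supportFunction {S : Fan N} (hF : S.IsFano) :
    ∃ F : RealSpace N → ℝ, (∀ σ ∈ S.cones, ∃ m : Module.Dual ℝ (RealSpace N), ∀ x ∈ σ, F x = m x) ∧
      (∀ n ∈ S.rayVectors, F (toReal n) = -1) ∧
      (∀ x, ∃ m ∈ S.polytope, m x = F x ∧ ∃ D : Set (RealSpace N),
        (∃ σ ∈ S.cones, D ⊆ (σ : Set (RealSpace N))) ∧
        ∀ n ∈ S.rayVectors, m (toReal n) = -1 → toReal n ∈ D) := by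
  obtain ⟨hc, F, hlin, ⟨hconc, hdom⟩, hray⟩ := hF
  have hhom : ∀ c : ℝ, 0 < c → ∀ x, F (c • x) = c * F x := by
    intro c hcpos x
    obtain ⟨σ, hσ, hx⟩ := hc x
    obtain ⟨m, -, hm⟩ := hlin σ hσ
    rw [hm _ (PointedCone.smul_mem _ hcpos.le hx), hm x hx, map_smul, smul_eq_mul]
  have hadd : ∀ x y, F x + F y ≤ F (x + y) := by
    intro x y
    have h2 : (0 : ℝ) ≤ 1 / 2 := by norm_num
    have h := hconc.2 (Set.mem_univ x) (Set.mem_univ y) h2 h2 (by norm_num)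
    rw [← smul_add _ x y, hhom _ (by norm_num)] at h
    simp only [smul_eq_mul] at h
    linarith
  refine ⟨F, fun σ hσ => ?_, hray, fun x => ?_⟩
  · obtain ⟨m, -, hm⟩ := hlin σ hσ
    exact ⟨m, hm⟩
  · obtain ⟨m, hm, hmx⟩ := exists_dual_ge_eq hhom hadd x
    -- The contact set of `F` with the touching functional is convex by concavity, and `F` is linear
    -- on it, so strict convexity puts it inside a cone.
    refine ⟨m, fun n hn => by rw [← hray n hn]; exact hm _, hmx, {y | F y = m y},
      hdom _ ?_ ⟨m, fun y hy => hy⟩, fun n hn h => ?_⟩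
    · intro y hy z hz a c ha hc' hac
      refine le_antisymm (hm _) ?_
      have h := hconc.2 (Set.mem_univ y) (Set.mem_univ z) ha hc' hac
      rw [Set.mem_ofPred_eq.mp hy, Set.mem_ofPred_eq.mp hz] at h
      simpa using h
    · rw [Set.mem_ofPred_eq, h, hray n hn]

/-- The generators of degree one of the cone over `Δ*`. -/
def degreeOneGenerators (S : Fan N) : Set (N × ℕ) :=
  insert (0, 1) ((fun n => (n, 1)) '' S.rayVectors)

theorem one_mem_coneSemigroup (S : Fan N) : ((0 : N), 1) ∈ S.coneSemigroup := by
  intro m _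
  simp

theorem degreeOneGenerators_subset (S : Fan N) :
    S.degreeOneGenerators ⊆ (S.coneSemigroup : Set (N × ℕ)) := by
  rintro _ (rfl | ⟨n, hn, rfl⟩)
  · exact S.one_mem_coneSemigroup
  · exact S.ray_mem_coneSemigroup ⟨n, hn⟩

variable [Module.Free ℤ N] [Module.Finite ℤ N]

/-- A lattice point of a cone lies in the semigroup generated by the rays, at the height
prescribed by the support function. -/
theorem exists_mem_closure_height (S : Fan N) (hS : S.IsSmooth) {F : RealSpace N → ℝ}
    {σ : PointedCone ℝ (RealSpace N)} (hσ : σ ∈ S.cones)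
    (hFσ : ∃ m : Module.Dual ℝ (RealSpace N), ∀ x ∈ σ, F x = m x)
    (hF : ∀ n ∈ S.rayVectors, F (toReal n) = -1) {n : N} (hn : toReal n ∈ σ) :
    ∃ k : ℕ, F (toReal n) = -k ∧ (n, k) ∈ AddSubmonoid.closure S.degreeOneGenerators := by
  obtain ⟨m, hm⟩ := hFσ
  rw [hm _ hn]
  have h := S.mem_closure_of_mem_cone hS hσ hn
  induction h using AddSubmonoid.closure_induction with
  | mem x h =>
    refine ⟨1, ?_, AddSubmonoid.subset_closure (Set.mem_insert_of_mem _ ⟨x, h.1, rfl⟩)⟩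
    rw [← hm _ h.2, hF x h.1, Nat.cast_one]
  | zero => exact ⟨0, by simp, zero_mem _⟩
  | add x y hx hy ihx ihy =>
    have hmem : ∀ z ∈ AddSubmonoid.closure {n | n ∈ S.rayVectors ∧ toReal n ∈ σ},
        toReal z ∈ σ := by
      intro z hz
      induction hz using AddSubmonoid.closure_induction with
      | mem x h => exact h.2
      | zero => rw [toReal_zero]; exact zero_mem _
      | add x y _ _ hx hy => rw [toReal_add]; exact add_mem hx hy
    obtain ⟨k, hk, hk'⟩ := ihx (hmem x hx)
    obtain ⟨l, hl, hl'⟩ := ihy (hmem y hy)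
    exact ⟨k + l, by rw [toReal_add, map_add, hk, hl]; push_cast; ring, add_mem hk' hl'⟩

/-- The polytope `Δ*` of a smooth Fano fan is normal, and its only lattice points are the origin and
the primitive vectors of the rays. -/
theorem coneSemigroup_eq_closure (S : Fan N) (hS : S.IsSmooth) (hF : S.IsFano) :
    S.coneSemigroup = AddSubmonoid.closure S.degreeOneGenerators := by
  refine le_antisymm ?_ (AddSubmonoid.closure_le.mpr S.degreeOneGenerators_subset)
  rintro ⟨n, k⟩ hnk
  obtain ⟨F, hlin, hray, htouch⟩ := hF.exists_supportFunction
  obtain ⟨σ, hσ, hn⟩ := hF.1 (toReal n)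
  obtain ⟨l, hl, hmem⟩ := S.exists_mem_closure_height hS hσ (hlin σ hσ) hray hn
  -- The functional touching `F` at `n` lies in `Δ`, which forces `l ≤ k`; copies of `(0, 1)` make
  -- up the missing height.
  obtain ⟨m, hm, hmn, -⟩ := htouch (toReal n)
  have h1 : -(k : ℝ) ≤ m (toReal n) := hnk m hm
  rw [hmn, hl] at h1
  have hlk : l ≤ k := by exact_mod_cast neg_le_neg_iff.mp h1
  have h2 : (n, k) = (n, l) + (k - l) • ((0 : N), 1) := by
    ext <;> simp [hlk]
  rw [h2]
  exact add_mem hmem (nsmul_mem (AddSubmonoid.subset_closure (Set.mem_insert _ _)) _)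

/-- By completeness `n` lies in some cone, and the height `-F n` works. This makes every Laurent
monomial the restriction of a section. -/
theorem exists_mem_coneSemigroup (S : Fan N) (hS : S.IsSmooth) (hF : S.IsFano) (n : N) :
    ∃ k : ℕ, (n, k) ∈ S.coneSemigroup := by
  obtain ⟨F, hlin, hray, -⟩ := hF.exists_supportFunction
  obtain ⟨σ, hσ, hn⟩ := hF.1 (toReal n)
  obtain ⟨l, -, hmem⟩ := S.exists_mem_closure_height hS hσ (hlin σ hσ) hray hn
  exact ⟨l, S.coneSemigroup_eq_closure hS hF ▸ hmem⟩

/-- If rays do not lie in a common cone, the sum of their primitive vectors has smaller height than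
expected. -/
theorem sum_mem_coneSemigroup_of_not_cone (S : Fan N) (hS : S.IsSmooth) (hF : S.IsFano)
    (T : Finset S.rayVectors) (hT : ¬ ∃ σ ∈ S.cones, ∀ ρ ∈ T, toReal ρ.1 ∈ σ) :
    ∃ k : ℕ, k + 1 = T.card ∧ (∑ ρ ∈ T, ρ.1, k) ∈ S.coneSemigroup := by
  obtain ⟨F, hlin, hray, htouch⟩ := hF.exists_supportFunction
  set n : N := ∑ ρ ∈ T, ρ.1 with hndef
  obtain ⟨σ, hσ, hn⟩ := hF.1 (toReal n)
  obtain ⟨l, hl, hmem⟩ := S.exists_mem_closure_height hS hσ (hlin σ hσ) hray hn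
  obtain ⟨m, hm, hmn, D, ⟨τ, hτ, hD⟩, hmD⟩ := htouch (toReal n)
  have hsum : m (toReal n) = ∑ ρ ∈ T, m (toReal ρ.1) := by
    rw [hndef, toReal_sum, map_sum]
  have hge : ∀ ρ ∈ T, -1 ≤ m (toReal ρ.1) := fun ρ _ => hm ρ.1 ρ.2
  -- Equality would give `m = -1` at every vector of `T`, placing all of them in the contact set and
  -- hence in one cone.
  have hlt : ∑ ρ ∈ T, (-1 : ℝ) < ∑ ρ ∈ T, m (toReal ρ.1) := by
    refine lt_of_le_of_ne (Finset.sum_le_sum hge) fun h => hT ⟨τ, hτ, fun ρ hρ => ?_⟩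
    exact hD (hmD ρ.1 ρ.2 ((Finset.sum_eq_sum_iff_of_le hge).mp h ρ hρ).symm)
  rw [← hsum, hmn, hl, Finset.sum_const, nsmul_eq_mul, mul_neg_one, neg_lt_neg_iff] at hlt
  have hlT : l < T.card := by exact_mod_cast hlt
  refine ⟨T.card - 1, by omega, ?_⟩
  have h2 : (n, T.card - 1) = (n, l) + (T.card - 1 - l) • ((0 : N), 1) := by
    ext
    · simp
    · simp; omega
  rw [h2, S.coneSemigroup_eq_closure hS hF]
  exact add_mem hmem (nsmul_mem (AddSubmonoid.subset_closure (Set.mem_insert _ _)) _)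

end Fan

/-! ### Degree-one sections, and their vanishing at boundary points of the critical scheme. -/

namespace Fan

variable (K : Type u) [Field K] {N : Type v} [AddCommGroup N]

/-- The section `x^0 t` of `𝒪(1)`. -/
def unitSection (S : Fan N) : S.sectionRing K :=
  AddMonoidAlgebra.single ⟨(0, 1), S.one_mem_coneSemigroup⟩ 1

/-- The section `x^{n_ρ} t` of `𝒪(1)`. -/
def raySection (S : Fan N) (ρ : S.rayVectors) : S.sectionRing K :=
  AddMonoidAlgebra.single ⟨(ρ.1, 1), S.ray_mem_coneSemigroup ρ⟩ 1

theorem unitSection_mem (S : Fan N) : S.unitSection K ∈ S.sectionGrading K 1 :=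
  AddMonoidAlgebra.single_mem_gradeBy S.degree
    (⟨(0, 1), S.one_mem_coneSemigroup⟩ : S.coneSemigroup) _

theorem prod_raySection (S : Fan N) (T : Finset S.rayVectors)
    (h : (∑ ρ ∈ T, ρ.1, T.card) ∈ S.coneSemigroup) :
    ∏ ρ ∈ T, S.raySection K ρ = AddMonoidAlgebra.single ⟨(∑ ρ ∈ T, ρ.1, T.card), h⟩ 1 := by
  classical
  induction T using Finset.induction_on with
  | empty =>
    rw [Finset.prod_empty, AddMonoidAlgebra.one_def]
    congr 1
  | insert ρ T hρ ih =>
    have hT : (∑ ρ ∈ T, ρ.1, T.card) ∈ S.coneSemigroup := by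
      have h1 := sum_mem (S := S.coneSemigroup) fun ρ (_ : ρ ∈ T) => S.ray_mem_coneSemigroup ρ
      have h2 : (∑ ρ ∈ T, ρ.1, T.card) = ∑ ρ ∈ T, (ρ.1, 1) := by
        ext <;> simp [Prod.fst_sum, Prod.snd_sum]
      rwa [h2]
    rw [Finset.prod_insert hρ, ih hT, raySection, AddMonoidAlgebra.single_mul_single, one_mul]
    congr 1
    ext
    · simp [Finset.sum_insert hρ]
    · simp [Finset.card_insert_of_notMem hρ, add_comm]

variable [Module.Free ℤ N] [Module.Finite ℤ N]

variable {K} in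
theorem logDerivSection_eq_sum (S : Fan N) (b : S.rayVectors → K) (m : Module.Dual ℤ N) :
    S.logDerivSection b m = ∑ ρ, ((m ρ.1 : K) * b ρ) • S.raySection K ρ := by
  rw [logDerivSection, potentialSection, map_sum]
  refine Finset.sum_congr rfl fun ρ _ => ?_
  rw [logDeriv_single, raySection, AddMonoidAlgebra.smul_single, smul_eq_mul, mul_one]
  rfl

theorem adjoin_sections (S : Fan N) (hS : S.IsSmooth) (hF : S.IsFano) :
    Algebra.adjoin K (insert (S.unitSection K) (Set.range (S.raySection K))) = ⊤ := by
  set U := Algebra.adjoin K (insert (S.unitSection K) (Set.range (S.raySection K)))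
  have key : ∀ c ∈ AddSubmonoid.closure S.degreeOneGenerators, ∀ h : c ∈ S.coneSemigroup,
      (AddMonoidAlgebra.single ⟨c, h⟩ 1 : S.sectionRing K) ∈ U := by
    intro c hc
    induction hc using AddSubmonoid.closure_induction with
    | mem c h =>
      intro hc
      rcases h with rfl | ⟨n, hn, rfl⟩
      · exact Algebra.subset_adjoin (Set.mem_insert _ _)
      · exact Algebra.subset_adjoin (Set.mem_insert_of_mem _ ⟨⟨n, hn⟩, rfl⟩)
    | zero => exact fun _ => one_mem U
    | add x y hx hy ihx ihy =>
      intro h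
      rw [← S.coneSemigroup_eq_closure hS hF] at hx hy
      have h1 := mul_mem (ihx hx) (ihy hy)
      rwa [AddMonoidAlgebra.single_mul_single, one_mul] at h1
  rw [eq_top_iff]
  intro f _
  induction f using AddMonoidAlgebra.induction_linear with
  | zero => exact zero_mem U
  | add f g hf hg => exact add_mem (hf trivial) (hg trivial)
  | single c a =>
    have h1 := U.smul_mem (key c.1 (S.coneSemigroup_eq_closure hS hF ▸ c.2) c.2) a
    rwa [AddMonoidAlgebra.smul_single, smul_eq_mul, mul_one] at h1

variable {K} in
/-- The sections `∂_m W` and `x^0 t` have no common zero on the dual toric variety. -/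
theorem raySection_mem_of_isPrime (S : Fan N) (hS : S.IsSmooth) (hF : S.IsFano)
    {b : S.rayVectors → K} (hb : ∀ ρ, b ρ ≠ 0) {p : Ideal (S.sectionRing K)} (hp : p.IsPrime)
    (hI : (S.logDerivIdeal b).toIdeal ≤ p) (ht : S.unitSection K ∈ p) (ρ : S.rayVectors) :
    S.raySection K ρ ∈ p := by
  classical
  -- If the rays in `T` shared no cone, the product of their sections would be a multiple of `x^0
  -- t`, so the prime `p` would contain one of them.
  let T : Finset S.rayVectors := Finset.univ.filter fun ρ => S.raySection K ρ ∉ p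
  obtain ⟨σ, hσ, hT⟩ : ∃ σ ∈ S.cones, ∀ ρ ∈ T, toReal ρ.1 ∈ σ := by
    by_contra hcon
    obtain ⟨k, hk, hmem⟩ := S.sum_mem_coneSemigroup_of_not_cone hS hF T hcon
    have h1 : (∑ ρ ∈ T, ρ.1, T.card) ∈ S.coneSemigroup := by
      have := add_mem hmem S.one_mem_coneSemigroup
      rwa [Prod.mk_add_mk, add_zero, hk] at this
    have h2 : ∏ ρ ∈ T, S.raySection K ρ ∈ p := by
      have h3 : ∏ ρ ∈ T, S.raySection K ρ =
          AddMonoidAlgebra.single ⟨(∑ ρ ∈ T, ρ.1, k), hmem⟩ 1 * S.unitSection K := by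
        rw [S.prod_raySection K T h1, unitSection, AddMonoidAlgebra.single_mul_single, one_mul]
        congr 1
        ext
        · simp
        · simp [hk]
      rw [h3]
      exact p.mul_mem_left _ ht
    obtain ⟨ρ, hρ, hρp⟩ := (hp.prod_mem_iff).mp h2
    exact (Finset.mem_filter.mp hρ).2 hρp
  by_contra hρ
  have hρT : ρ ∈ T := Finset.mem_filter.mpr ⟨Finset.mem_univ _, hρ⟩
  obtain ⟨e, he⟩ := hS σ hσ
  obtain ⟨i, hi⟩ := he ρ.1 ρ.2 (hT ρ hρT)
  -- The coordinate `e.coord i` is 1 on `n_ρ` and 0 on the other vectors of `T`, so modulo `p` only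
  -- the term `b_ρ x^{n_ρ} t` survives.
  have hder : S.logDerivSection b (e.coord i) ∈ p := hI (Ideal.subset_span ⟨_, rfl⟩)
  rw [logDerivSection_eq_sum, ← Finset.add_sum_erase _ _ (Finset.mem_univ ρ)] at hder
  have hrest : ∑ ρ' ∈ Finset.univ.erase ρ,
      (((e.coord i) ρ'.1 : K) * b ρ') • S.raySection K ρ' ∈ p := by
    refine sum_mem fun ρ' hρ' => ?_
    by_cases h : ρ' ∈ T
    · obtain ⟨j, hj⟩ := he ρ'.1 ρ'.2 (hT ρ' h)
      have hji : j ≠ i := by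
        rintro rfl
        have : ρ' = ρ := Subtype.ext (hj.symm.trans hi)
        simp [this] at hρ'
      rw [← hj, Module.Basis.coord_apply, e.repr_self, Finsupp.single_eq_of_ne hji.symm]
      simp
    · have hmem : S.raySection K ρ' ∈ p := by
        by_contra h'
        exact h (Finset.mem_filter.mpr ⟨Finset.mem_univ _, h'⟩)
      exact p.smul_of_tower_mem _ hmem
  have h1 := (Ideal.add_mem_iff_left p hrest).mp hder
  rw [← hi, Module.Basis.coord_apply, e.repr_self, Finsupp.single_eq_same, Int.cast_one,
    one_mul] at h1
  have h2 := p.smul_of_tower_mem (b ρ)⁻¹ h1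
  rw [inv_smul_smul₀ (hb ρ)] at h2
  exact hρ h2

end Fan

theorem gradeBy_le_of_single_mem {K : Type u} [Field K] {G ι : Type*} {f : G → ι}
    {i : ι} {Q : Submodule K (AddMonoidAlgebra K G)}
    (h : ∀ c, f c = i → (AddMonoidAlgebra.single c 1 : AddMonoidAlgebra K G) ∈ Q) :
    AddMonoidAlgebra.gradeBy K f i ≤ Q := by
  intro a ha
  rw [← AddMonoidAlgebra.sum_coeff_single a]
  refine sum_mem fun c hc => ?_
  have h1 := Q.smul_mem (a.coeff c) (h c ((AddMonoidAlgebra.mem_gradeBy_iff _ _ _ _).mp ha hc))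
  rwa [AddMonoidAlgebra.smul_single, smul_eq_mul, mul_one] at h1

/-! ### Passing between homogeneous sections and Laurent polynomials. -/

namespace Fan

variable (K : Type u) [Field K] {N : Type v} [AddCommGroup N]

/-- Restriction of sections to the torus, trivialized by `x^0 t`: the map `x^n t^k ↦ x^n`. -/
def dehomogenize (S : Fan N) : S.sectionRing K →ₐ[K] AddMonoidAlgebra K N :=
  AddMonoidAlgebra.mapDomainAlgHom K K S.lattice

@[simp] theorem dehomogenize_single (S : Fan N) (c : S.coneSemigroup) (a : K) :
    S.dehomogenize K (AddMonoidAlgebra.single c a) = AddMonoidAlgebra.single c.1.1 a := by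
  simp [dehomogenize, lattice]

theorem dehomogenize_unitSection (S : Fan N) : S.dehomogenize K (S.unitSection K) = 1 := by
  rw [unitSection, dehomogenize_single, AddMonoidAlgebra.one_def]

variable {K}

/-- Only the exponent of `t` is forgotten, and it is constant on a graded piece. -/
theorem dehomogenize_injOn (S : Fan N) (k : ℕ) :
    Set.InjOn (S.dehomogenize K) (S.sectionGrading K k : Set (S.sectionRing K)) := by
  intro x hx y hy hxy
  apply AddMonoidAlgebra.coeff_injective
  refine Finsupp.mapDomain_injOn (f := S.lattice) (S.degree ⁻¹' {k}) ?_ hx hy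
    (congrArg AddMonoidAlgebra.coeff hxy)
  intro c hc d hd h
  have h1 : c.1.2 = k := hc
  have h2 : d.1.2 = k := hd
  exact Subtype.ext (Prod.ext h (h1.trans h2.symm))

theorem unitSection_pow_mul_mem (S : Fan N) (l : ℕ) {k : ℕ} {a : S.sectionRing K}
    (ha : a ∈ S.sectionGrading K k) : S.unitSection K ^ l * a ∈ S.sectionGrading K (l + k) := by
  have h := SetLike.pow_mem_graded (A := S.sectionGrading K) l (S.unitSection_mem K)
  rw [smul_eq_mul, mul_one] at h
  exact SetLike.mul_mem_graded h ha

theorem dehomogenize_unitSection_pow_mul (S : Fan N) (l : ℕ) (a : S.sectionRing K) :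
    S.dehomogenize K (S.unitSection K ^ l * a) = S.dehomogenize K a := by
  rw [map_mul, map_pow, dehomogenize_unitSection, one_pow, one_mul]

variable [Module.Free ℤ N] [Module.Finite ℤ N]

/-- Monomials lift individually; lifts of different degrees are brought to a common degree by powers
of `x^0 t`, which restrict to 1. -/
theorem exists_dehomogenize_eq (S : Fan N) (hS : S.IsSmooth) (hF : S.IsFano)
    (f : AddMonoidAlgebra K N) : ∃ k, ∃ a ∈ S.sectionGrading K k, S.dehomogenize K a = f := by
  induction f using AddMonoidAlgebra.induction_linear with
  | zero => exact ⟨0, 0, zero_mem _, map_zero _⟩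
  | add f g hf hg =>
    obtain ⟨k, a, ha, rfl⟩ := hf
    obtain ⟨l, c, hc, rfl⟩ := hg
    refine ⟨l + k, S.unitSection K ^ l * a + S.unitSection K ^ k * c,
      add_mem (S.unitSection_pow_mul_mem l ha) ?_, ?_⟩
    · rw [add_comm l k]
      exact S.unitSection_pow_mul_mem k hc
    · rw [map_add, dehomogenize_unitSection_pow_mul, dehomogenize_unitSection_pow_mul]
  | single n x =>
    obtain ⟨k, hk⟩ := S.exists_mem_coneSemigroup hS hF n
    exact ⟨k, AddMonoidAlgebra.single ⟨(n, k), hk⟩ x,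
      AddMonoidAlgebra.single_mem_gradeBy S.degree (⟨(n, k), hk⟩ : S.coneSemigroup) _,
      dehomogenize_single _ _ _ _⟩

theorem dehomogenize_logDerivSection (S : Fan N) (b : S.rayVectors → K) (m : Module.Dual ℤ N) :
    S.dehomogenize K (S.logDerivSection b m) = logDeriv K m.toAddMonoidHom (S.potential b) := by
  rw [logDerivSection, potentialSection, potential, map_sum, map_sum, map_sum]
  refine Finset.sum_congr rfl fun ρ _ => ?_
  rw [logDeriv_single, logDeriv_single, dehomogenize_single]
  rfl

theorem logDerivIdeal_le_comap (S : Fan N) (b : S.rayVectors → K) :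
    (S.logDerivIdeal b).toIdeal ≤ (jacobianIdeal (S.potential b)).comap (S.dehomogenize K) := by
  refine Ideal.span_le.mpr ?_
  rintro _ ⟨m, rfl⟩
  change S.dehomogenize K _ ∈ jacobianIdeal (S.potential b)
  rw [dehomogenize_logDerivSection]
  exact Ideal.subset_span ⟨m, rfl⟩

/-- The generators lift to the sections `∂_m W`, and equalizing degrees by powers of `x^0 t` stays
inside the ideal. -/
theorem exists_mem_logDerivIdeal_dehomogenize_eq (S : Fan N) (hS : S.IsSmooth) (hF : S.IsFano)
    (b : S.rayVectors → K) {f : AddMonoidAlgebra K N} (hf : f ∈ jacobianIdeal (S.potential b)) :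
    ∃ k, ∃ a ∈ S.sectionGrading K k, a ∈ (S.logDerivIdeal b).toIdeal ∧ S.dehomogenize K a = f := by
  induction hf using Submodule.span_induction with
  | mem x h =>
    obtain ⟨m, rfl⟩ := h
    exact ⟨1, S.logDerivSection b m, S.logDerivSection_mem b m, Ideal.subset_span ⟨m, rfl⟩,
      S.dehomogenize_logDerivSection b m⟩
  | zero => exact ⟨0, 0, zero_mem _, zero_mem _, map_zero _⟩
  | add f g _ _ hf hg =>
    obtain ⟨k, a, ha, haI, rfl⟩ := hf
    obtain ⟨l, c, hc, hcI, rfl⟩ := hg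
    refine ⟨l + k, S.unitSection K ^ l * a + S.unitSection K ^ k * c,
      add_mem (S.unitSection_pow_mul_mem l ha) ?_,
      add_mem (Ideal.mul_mem_left _ _ haI) (Ideal.mul_mem_left _ _ hcI), ?_⟩
    · rw [add_comm l k]
      exact S.unitSection_pow_mul_mem k hc
    · rw [map_add, dehomogenize_unitSection_pow_mul, dehomogenize_unitSection_pow_mul]
  | smul g f _ hf =>
    obtain ⟨k, a, ha, haI, rfl⟩ := hf
    obtain ⟨l, c, hc, rfl⟩ := S.exists_dehomogenize_eq hS hF g
    exact ⟨l + k, c * a, SetLike.mul_mem_graded hc ha, Ideal.mul_mem_left _ _ haI, map_mul _ _ _⟩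

/-- A homogeneous section that vanishes on the critical scheme inside the torus lies in the
homogeneous ideal of the critical scheme, up to a power of `x^0 t`. -/
theorem exists_unitSection_pow_mul_mem_logDerivIdeal (S : Fan N) (hS : S.IsSmooth) (hF : S.IsFano)
    (b : S.rayVectors → K) {k : ℕ} {a : S.sectionRing K} (ha : a ∈ S.sectionGrading K k)
    (h : S.dehomogenize K a ∈ jacobianIdeal (S.potential b)) :
    ∃ l, S.unitSection K ^ l * a ∈ (S.logDerivIdeal b).toIdeal := by
  obtain ⟨l, c, hc, hcI, hca⟩ := S.exists_mem_logDerivIdeal_dehomogenize_eq hS hF b h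
  refine ⟨l, ?_⟩
  -- Both sides have degree `l + k` and the same restriction to the torus.
  have h1 : S.unitSection K ^ l * a = S.unitSection K ^ k * c := by
    refine S.dehomogenize_injOn (l + k) (S.unitSection_pow_mul_mem l ha) ?_ ?_
    · rw [add_comm]
      exact S.unitSection_pow_mul_mem k hc
    · rw [dehomogenize_unitSection_pow_mul, dehomogenize_unitSection_pow_mul, hca]
  rw [h1]
  exact Ideal.mul_mem_left _ _ hcI

end Fan

/-! ### Projective schemes that are affine. -/

section ProjAffine

open CategoryTheory HomogeneousLocalization

variable {R : Type u} {A : Type v} [CommRing R] [CommRing A] [Algebra R A]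
  (𝒜 : ℕ → Submodule R A) [GradedAlgebra 𝒜]

/-- The chart of `f` is an open immersion, and it is surjective here, hence an isomorphism.
Compatibility with scalars is recorded so that the final isomorphism is one of `K`-algebras. -/
theorem exists_ringEquiv_away_of_basicOpen_eq_top {f : A} {d : ℕ} (hf : f ∈ 𝒜 d) (hd : 0 < d)
    (h : Proj.basicOpen 𝒜 f = ⊤) :
    IsAffine (Proj 𝒜) ∧ ∃ e : Γ(Proj 𝒜, ⊤) ≃+* Away 𝒜 f,
      ∀ r, e (projAlgebraMap 𝒜 r) = fromZeroRingHom 𝒜 _ (algebraMap R (𝒜 0) r) := by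
  have : IsIso (Proj.awayι 𝒜 f hf hd) := by
    have : Epi (Proj.awayι 𝒜 f hf hd).base := by
      rw [TopCat.epi_iff_surjective]
      intro x
      have hx : x ∈ (Proj.awayι 𝒜 f hf hd).opensRange := by
        rw [Proj.opensRange_awayι, h]; trivial
      exact hx
    exact IsOpenImmersion.isIso _
  refine ⟨.of_isIso (inv (Proj.awayι 𝒜 f hf hd)), ?_⟩
  have : IsIso (Proj.awayι 𝒜 f hf hd).appTop :=
    inferInstanceAs (IsIso (Scheme.Γ.map (Proj.awayι 𝒜 f hf hd).op))
  let e : Γ(Proj 𝒜, ⊤) ≅ .of (Away 𝒜 f) :=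
    asIso (Proj.awayι 𝒜 f hf hd).appTop ≪≫ Scheme.ΓSpecIso _
  refine ⟨e.commRingCatIsoToRingEquiv, fun r => ?_⟩
  have key : (Scheme.ΓSpecIso (.of (𝒜 0))).inv ≫ (Proj.toSpecZero 𝒜).appTop ≫ e.hom =
      CommRingCat.ofHom (fromZeroRingHom 𝒜 _) := by
    simp only [e, Iso.trans_hom, asIso_hom]
    rw [← Scheme.Hom.comp_appTop_assoc, Proj.awayι_toSpecZero, Scheme.ΓSpecIso_naturality,
      Iso.inv_hom_id_assoc]
  exact congr($(key).hom (algebraMap R (𝒜 0) r))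

/-- Affine projective schemes are finite. -/
theorem finite_projAlgebraMap_of_isAffine [IsAffine (Proj 𝒜)] [Algebra.FiniteType R A]
    (h0 : Function.Surjective (algebraMap R (𝒜 0))) : (projAlgebraMap 𝒜).Finite := by
  have := IsScalarTower.of_algebraMap_eq (R := R) (S := 𝒜 0) (A := A) fun _ => rfl
  have : Algebra.FiniteType (𝒜 0) A := .of_restrictScalars_finiteType R _ _
  -- A proper affine morphism is finite.
  have : IsFinite (Proj.toSpecZero 𝒜) :=
    IsFinite.iff_isProper_and_isAffineHom.mpr ⟨inferInstance, inferInstance⟩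
  have h1 := (Proj.toSpecZero 𝒜).finite_appTop
  refine RingHom.Finite.comp (RingHom.Finite.comp h1 (.of_surjective _ ?_)) (.of_surjective _ h0)
  exact (Scheme.ΓSpecIso (.of (𝒜 0))).symm.commRingCatIsoToRingEquiv.surjective

end ProjAffine

/-! ### The critical scheme as the spectrum of `K[N] / J_W`. -/

namespace Fan

open HomogeneousLocalization

variable {K : Type u} [Field K] {N : Type v} [AddCommGroup N]
  [Module.Free ℤ N] [Module.Finite ℤ N]

/-- The homogeneous coordinate ring of the critical scheme. -/
abbrev criticalRing (S : Fan N) (b : S.rayVectors → K) : Type max u v :=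
  S.sectionRing K ⧸ (S.logDerivIdeal b).toIdeal

/-- The grading of the homogeneous coordinate ring of the critical scheme. -/
abbrev criticalGrading (S : Fan N) (b : S.rayVectors → K) :
    ℕ → Submodule K (S.criticalRing b) :=
  quotientGrading (S.sectionGrading K) (S.logDerivIdeal b)

/-- The class of the section `x^0 t` in the homogeneous coordinate ring of the critical scheme. -/
def criticalUnit (S : Fan N) (b : S.rayVectors → K) : S.criticalRing b :=
  Ideal.Quotient.mk _ (S.unitSection K)

theorem criticalUnit_mem (S : Fan N) (b : S.rayVectors → K) :
    S.criticalUnit b ∈ S.criticalGrading b 1 :=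
  mk_mem_quotientGrading _ _ (S.unitSection_mem K)

/-- The critical scheme is contained in the torus. -/
theorem basicOpen_criticalUnit_eq_top (S : Fan N) (hS : S.IsSmooth) (hF : S.IsFano)
    {b : S.rayVectors → K} (hb : ∀ ρ, b ρ ≠ 0) :
    Proj.basicOpen (S.criticalGrading b) (S.criticalUnit b) = ⊤ := by
  rw [eq_top_iff]
  intro x _
  rw [Proj.mem_basicOpen]
  intro hx
  let p : Ideal (S.sectionRing K) :=
    x.asHomogeneousIdeal.toIdeal.comap (Ideal.Quotient.mk (S.logDerivIdeal b).toIdeal)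
  have hp : p.IsPrime := Ideal.IsPrime.comap (hK := x.isPrime) _
  have hI : (S.logDerivIdeal b).toIdeal ≤ p := by
    intro a ha
    change Ideal.Quotient.mk _ a ∈ x.asHomogeneousIdeal.toIdeal
    rw [Ideal.Quotient.eq_zero_iff_mem.mpr ha]
    exact zero_mem _
  have hray := S.raySection_mem_of_isPrime hS hF hb hp hI hx
  -- All degree-one generators lie in `p`, hence so does every monomial other than 1. The point
  -- would then contain the irrelevant ideal.
  have key : ∀ c ∈ AddSubmonoid.closure S.degreeOneGenerators, ∀ h : c ∈ S.coneSemigroup,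
      c = 0 ∨ (AddMonoidAlgebra.single ⟨c, h⟩ 1 : S.sectionRing K) ∈ p := by
    intro c hc
    induction hc using AddSubmonoid.closure_induction with
    | mem c h =>
      intro hc
      rcases h with rfl | ⟨n, hn, rfl⟩
      · exact .inr hx
      · exact .inr (hray ⟨n, hn⟩)
    | zero => exact fun _ => .inl rfl
    | add y z hy hz ihy ihz =>
      intro h
      rw [← S.coneSemigroup_eq_closure hS hF] at hy hz
      have h1 : (AddMonoidAlgebra.single ⟨y + z, h⟩ 1 : S.sectionRing K) =
          AddMonoidAlgebra.single ⟨y, hy⟩ 1 * AddMonoidAlgebra.single ⟨z, hz⟩ 1 := by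
        rw [AddMonoidAlgebra.single_mul_single, one_mul]; rfl
      rcases ihy hy with hy0 | hy1
      · rcases ihz hz with hz0 | hz1
        · exact .inl (by rw [hy0, hz0, add_zero])
        · exact .inr (h1 ▸ p.mul_mem_left _ hz1)
      · exact .inr (h1 ▸ p.mul_mem_right _ hy1)
  refine x.not_irrelevant_le ?_
  rw [← toIdeal_le_toIdeal_iff, HomogeneousIdeal.toIdeal_irrelevant_le]
  rintro i hi _ ⟨a, ha, rfl⟩
  have h1 : S.sectionGrading K i ≤ p.restrictScalars K := by
    refine gradeBy_le_of_single_mem fun c hc => ?_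
    refine (key c.1 (S.coneSemigroup_eq_closure hS hF ▸ c.2) c.2).resolve_left fun h0 => ?_
    have h2 : c.1.2 = i := hc
    rw [h0, Prod.snd_zero] at h2
    exact hi.ne h2
  exact h1 ha

theorem finiteType_criticalRing (S : Fan N) (hS : S.IsSmooth) (hF : S.IsFano)
    (b : S.rayVectors → K) : Algebra.FiniteType K (S.criticalRing b) := by
  have : Algebra.FiniteType K (S.sectionRing K) := by
    refine ⟨(Subalgebra.fg_def).mpr ⟨_, ?_, S.adjoin_sections K hS hF⟩⟩
    exact (Set.finite_range _).insert _
  exact .of_surjective (Ideal.Quotient.mkₐ K (S.logDerivIdeal b).toIdeal)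
    (Ideal.Quotient.mkₐ_surjective _ _)

/-- The semigroup is generated in degree one, so its only element of degree zero is 0. Finiteness
over the degree-zero part thus becomes finiteness over `K`. -/
theorem algebraMap_criticalGrading_zero_surjective (S : Fan N) (hS : S.IsSmooth) (hF : S.IsFano)
    (b : S.rayVectors → K) : Function.Surjective (algebraMap K (S.criticalGrading b 0)) := by
  rintro ⟨_, a, ha, rfl⟩
  have key : ∀ c ∈ AddSubmonoid.closure S.degreeOneGenerators, c.2 = 0 → c = 0 := by
    intro c hc
    induction hc using AddSubmonoid.closure_induction with
    | mem c h =>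
      rintro hc
      rcases h with rfl | ⟨n, hn, rfl⟩
      · exact absurd hc one_ne_zero
      · exact absurd hc one_ne_zero
    | zero => exact fun _ => rfl
    | add y z _ _ ihy ihz =>
      intro h
      have h' : y.2 + z.2 = 0 := h
      rw [ihy (by omega), ihz (by omega), add_zero]
  have h1 : S.sectionGrading K 0 ≤ (⊥ : Subalgebra K (S.sectionRing K)).toSubmodule := by
    refine gradeBy_le_of_single_mem fun c hc => ?_
    have h2 : c = 0 := Subtype.ext (key c.1 (S.coneSemigroup_eq_closure hS hF ▸ c.2) hc)
    rw [h2, ← AddMonoidAlgebra.one_def]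
    exact one_mem (⊥ : Subalgebra K (S.sectionRing K))
  obtain ⟨r, rfl⟩ := Algebra.mem_bot.mp (h1 ha)
  exact ⟨r, rfl⟩

/-- The map to the functions on the scheme of critical points in the torus. -/
def criticalRingToJacobian (S : Fan N) (b : S.rayVectors → K) :
    S.criticalRing b →+* AddMonoidAlgebra K N ⧸ jacobianIdeal (S.potential b) :=
  Ideal.quotientMap _ (S.dehomogenize K).toRingHom (S.logDerivIdeal_le_comap b)

theorem criticalRingToJacobian_mk (S : Fan N) (b : S.rayVectors → K) (a : S.sectionRing K) :
    S.criticalRingToJacobian b (Ideal.Quotient.mk _ a) =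
      Ideal.Quotient.mk _ (S.dehomogenize K a) :=
  rfl

theorem criticalRingToJacobian_criticalUnit (S : Fan N) (b : S.rayVectors → K) :
    S.criticalRingToJacobian b (S.criticalUnit b) = 1 := by
  rw [criticalUnit, criticalRingToJacobian_mk, dehomogenize_unitSection, map_one]

/-- The map `(A / I)_(t) → K[N] / J_W`. -/
def awayToJacobian (S : Fan N) (b : S.rayVectors → K) :
    Away (S.criticalGrading b) (S.criticalUnit b) →+*
      AddMonoidAlgebra K N ⧸ jacobianIdeal (S.potential b) :=
  (Localization.awayLift (S.criticalRingToJacobian b) (S.criticalUnit b)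
    (by rw [criticalRingToJacobian_criticalUnit]; exact isUnit_one)).comp
    (algebraMap (Away (S.criticalGrading b) (S.criticalUnit b)) (Localization.Away _))

theorem awayToJacobian_mk (S : Fan N) (b : S.rayVectors → K) (k : ℕ) (x : S.criticalRing b)
    (hx : x ∈ S.criticalGrading b (k • 1)) :
    S.awayToJacobian b (Away.mk _ (S.criticalUnit_mem b) k x hx) =
      S.criticalRingToJacobian b x := by
  rw [awayToJacobian, RingHom.comp_apply, HomogeneousLocalization.algebraMap_apply, Away.val_mk,
    Localization.awayLift_mk (v := 1) _ _ _
      (by rw [criticalRingToJacobian_criticalUnit, mul_one]), one_pow, mul_one]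

/-- A fraction with image zero has a numerator that a power of `x^0 t` moves into the homogeneous
ideal, so it vanishes in the localization. Surjectivity comes from homogeneous lifts. -/
theorem awayToJacobian_bijective (S : Fan N) (hS : S.IsSmooth) (hF : S.IsFano)
    (b : S.rayVectors → K) : Function.Bijective (S.awayToJacobian b) := by
  constructor
  · rw [injective_iff_map_eq_zero]
    intro z hz
    obtain ⟨k, x, hx, rfl⟩ := Away.mk_surjective _ (S.criticalUnit_mem b) z
    rw [awayToJacobian_mk] at hz
    obtain ⟨a, ha, hax⟩ := id hx
    have hax' : Ideal.Quotient.mk _ a = x := hax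
    rw [← hax'] at hz
    obtain ⟨l, hl⟩ := S.exists_unitSection_pow_mul_mem_logDerivIdeal hS hF b ha
      (Ideal.Quotient.eq_zero_iff_mem.mp hz)
    apply HomogeneousLocalization.val_injective
    rw [Away.val_mk, HomogeneousLocalization.val_zero, Localization.mk_eq_mk',
      IsLocalization.mk'_eq_zero_iff]
    refine ⟨⟨_, l, rfl⟩, ?_⟩
    rw [← hax']
    exact (map_mul _ _ _).symm.trans (Ideal.Quotient.eq_zero_iff_mem.mpr hl)
  · intro y
    obtain ⟨f, rfl⟩ := Ideal.Quotient.mk_surjective y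
    obtain ⟨k, a, ha, rfl⟩ := S.exists_dehomogenize_eq hS hF f
    exact ⟨Away.mk _ (S.criticalUnit_mem b) k _ (mk_mem_quotientGrading _ _ (by simpa using ha)),
      awayToJacobian_mk _ _ _ _ _⟩

theorem awayToJacobian_algebraMap (S : Fan N) (b : S.rayVectors → K) (r : K) :
    S.awayToJacobian b (fromZeroRingHom _ _ (algebraMap K (S.criticalGrading b 0) r)) =
      algebraMap K _ r := by
  have h1 : (fromZeroRingHom (S.criticalGrading b) (Submonoid.powers (S.criticalUnit b))
      (algebraMap K (S.criticalGrading b 0) r)).val =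
      algebraMap _ _ (algebraMap K (S.criticalRing b) r) := rfl
  rw [awayToJacobian, RingHom.comp_apply, HomogeneousLocalization.algebraMap_apply, h1,
    IsLocalization.Away.lift_eq]
  change Ideal.Quotient.mk _ (S.dehomogenize K (algebraMap K _ r)) = _
  rw [AlgHom.commutes]
  rfl

theorem algebraMap_criticalFunctions (S : Fan N) (b : S.rayVectors → K) :
    algebraMap K (S.criticalFunctions b) = projAlgebraMap (S.criticalGrading b) := rfl

/-- The critical scheme is affine, with ring of functions `K[N] / J_W`. -/
theorem nonempty_criticalFunctions_algEquiv (S : Fan N) (hS : S.IsSmooth) (hF : S.IsFano)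
    {b : S.rayVectors → K} (hb : ∀ ρ, b ρ ≠ 0) :
    Nonempty (S.criticalFunctions b ≃ₐ[K]
      (AddMonoidAlgebra K N ⧸ jacobianIdeal (S.potential b))) := by
  obtain ⟨-, e, he⟩ := exists_ringEquiv_away_of_basicOpen_eq_top (S.criticalGrading b)
    (S.criticalUnit_mem b) one_pos (S.basicOpen_criticalUnit_eq_top hS hF hb)
  let e' : S.criticalFunctions b ≃+* AddMonoidAlgebra K N ⧸ jacobianIdeal (S.potential b) :=
    e.trans (RingEquiv.ofBijective _ (S.awayToJacobian_bijective hS hF b))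
  have h1 : ∀ r, e' (projAlgebraMap (S.criticalGrading b) r) = algebraMap K _ r := fun r =>
    (congrArg (S.awayToJacobian b) (he r)).trans (S.awayToJacobian_algebraMap b r)
  refine ⟨AlgEquiv.ofRingEquiv (f := e') fun r => ?_⟩
  rw [algebraMap_criticalFunctions]
  exact h1 r

theorem finite_criticalFunctions (S : Fan N) (hS : S.IsSmooth) (hF : S.IsFano)
    {b : S.rayVectors → K} (hb : ∀ ρ, b ρ ≠ 0) : Module.Finite K (S.criticalFunctions b) := by
  obtain ⟨_, -⟩ := exists_ringEquiv_away_of_basicOpen_eq_top (S.criticalGrading b)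
    (S.criticalUnit_mem b) one_pos (S.basicOpen_criticalUnit_eq_top hS hF hb)
  have := S.finiteType_criticalRing hS hF b
  have h := finite_projAlgebraMap_of_isAffine (S.criticalGrading b)
    (S.algebraMap_criticalGrading_zero_surjective hS hF b)
  rw [← RingHom.finite_algebraMap, algebraMap_criticalFunctions]
  exact h

end Fan

/-! ### Log-derivations, differentials and the Hessian. -/

section LogDerivations

variable (K : Type u) [Field K] {N : Type v} [AddCommGroup N]

/-- The log-derivative as a derivation. -/
def logDerivation (m : Module.Dual ℤ N) :
    Derivation K (AddMonoidAlgebra K N) (AddMonoidAlgebra K N) :=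
  Derivation.mk' (logDeriv K m.toAddMonoidHom) fun f g => by
    induction f using AddMonoidAlgebra.induction_linear with
    | zero => simp
    | add f f' hf hf' => simp only [add_mul, map_add, hf, hf', add_smul, smul_add]; abel
    | single n a =>
      induction g using AddMonoidAlgebra.induction_linear with
      | zero => simp
      | add g g' hg hg' => simp only [mul_add, map_add, hg, hg', add_smul, smul_add]; abel
      | single n' a' =>
        simp only [AddMonoidAlgebra.single_mul_single, logDeriv_single, smul_eq_mul]
        rw [add_comm n' n, ← AddMonoidAlgebra.single_add, map_add, Int.cast_add]
        congr 1
        ring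

theorem logDerivation_apply (m : Module.Dual ℤ N) (f : AddMonoidAlgebra K N) :
    logDerivation K m f = logDeriv K m.toAddMonoidHom f :=
  rfl

/-- The log-derivative `∂_m f` is linear in `m`. -/
def logDerivHom (f : AddMonoidAlgebra K N) : Module.Dual ℤ N →+ AddMonoidAlgebra K N where
  toFun m := logDerivation K m f
  map_zero' := by
    induction f using AddMonoidAlgebra.induction_linear with
    | zero => simp
    | add f f' hf hf' => rw [map_add, hf, hf', add_zero]
    | single n a => rw [logDerivation_apply, logDeriv_single]; simp
  map_add' m m' := by
    induction f using AddMonoidAlgebra.induction_linear with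
    | zero => simp
    | add f f' hf hf' => rw [map_add, map_add, map_add, hf, hf']; abel
    | single n a =>
      simp only [logDerivation_apply, logDeriv_single, ← AddMonoidAlgebra.single_add]
      congr 1
      simp [add_mul]

variable {K}

/-- A monomial is a unit of the Laurent polynomial ring. -/
theorem single_neg_mul_single (n : N) :
    (AddMonoidAlgebra.single (-n) 1 : AddMonoidAlgebra K N) * AddMonoidAlgebra.single n 1 = 1 := by
  rw [AddMonoidAlgebra.single_mul_single, one_mul, neg_add_cancel, AddMonoidAlgebra.one_def]

/-- The log-derivatives along a basis of `M` are a basis of the derivations of the Laurent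
polynomial ring. -/
theorem derivation_eq_sum_logDerivation {ι : Type*} [Fintype ι] [DecidableEq ι]
    {e : ι → Module.Dual ℤ N} {ν : ι → N} (hν : ∀ n, n = ∑ i, e i n • ν i)
    {M : Type*} [AddCommGroup M] [Module K M] [Module (AddMonoidAlgebra K N) M]
    [IsScalarTower K (AddMonoidAlgebra K N) M]
    (D : Derivation K (AddMonoidAlgebra K N) M) (f : AddMonoidAlgebra K N) :
    D f = ∑ i, logDerivation K (e i) f • (AddMonoidAlgebra.single (-ν i) (1 : K) :
      AddMonoidAlgebra K N) • D (AddMonoidAlgebra.single (ν i) 1) := by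
  -- The logarithmic differential `x^{-n} D(x^n)` is additive in `n` by the Leibniz rule, so its
  -- values on the `ν i` determine `D`.
  let θ : N →+ M := AddMonoidHom.mk' (fun n => (AddMonoidAlgebra.single (-n) (1 : K) :
      AddMonoidAlgebra K N) • D (AddMonoidAlgebra.single n 1)) fun n n' => by
    have h1 : (AddMonoidAlgebra.single (n + n') 1 : AddMonoidAlgebra K N) =
        AddMonoidAlgebra.single n 1 * AddMonoidAlgebra.single n' 1 := by
      rw [AddMonoidAlgebra.single_mul_single, one_mul]
    have h2 : (AddMonoidAlgebra.single (-(n + n')) 1 : AddMonoidAlgebra K N) =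
        AddMonoidAlgebra.single (-n) 1 * AddMonoidAlgebra.single (-n') 1 := by
      rw [AddMonoidAlgebra.single_mul_single, one_mul, neg_add]
    rw [h1, h2, D.leibniz, smul_add, smul_smul, smul_smul]
    rw [mul_right_comm, single_neg_mul_single, one_mul, mul_assoc, single_neg_mul_single, mul_one,
      add_comm]
  have hθ : ∀ n, D (AddMonoidAlgebra.single n 1) =
      (AddMonoidAlgebra.single n (1 : K) : AddMonoidAlgebra K N) • θ n := by
    intro n
    change _ = (AddMonoidAlgebra.single n (1 : K) : AddMonoidAlgebra K N) •
      (AddMonoidAlgebra.single (-n) (1 : K) : AddMonoidAlgebra K N) •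
        D (AddMonoidAlgebra.single n 1)
    rw [smul_smul, mul_comm, single_neg_mul_single, one_smul]
  induction f using AddMonoidAlgebra.induction_linear with
  | zero => simp
  | add f g hf hg => simp only [map_add, add_smul, Finset.sum_add_distrib, hf, hg]
  | single n a =>
    have h1 : (AddMonoidAlgebra.single n a : AddMonoidAlgebra K N) =
        a • AddMonoidAlgebra.single n 1 := by
      rw [AddMonoidAlgebra.smul_single, smul_eq_mul, mul_one]
    have h2 : θ n = ∑ i, ((e i n : ℤ) : AddMonoidAlgebra K N) • θ (ν i) := by
      nth_rewrite 1 [hν n]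
      rw [map_sum]
      refine Finset.sum_congr rfl fun i _ => ?_
      rw [map_zsmul, Int.cast_smul_eq_zsmul]
    rw [h1, Derivation.map_smul, hθ, h2, Finset.smul_sum, Finset.smul_sum]
    refine Finset.sum_congr rfl fun i _ => ?_
    rw [Derivation.map_smul, logDerivation_apply, logDeriv_single, smul_assoc, smul_smul]
    congr 2
    rw [AddMonoidAlgebra.intCast_def, AddMonoidAlgebra.single_mul_single]
    simp

theorem mem_jacobianIdeal (f : AddMonoidAlgebra K N) (m : Module.Dual ℤ N) :
    logDerivation K m f ∈ jacobianIdeal f :=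
  Ideal.subset_span ⟨m, rfl⟩

theorem isCriticalPoint_iff (f : AddMonoidAlgebra K N)
    (p : PrimeSpectrum (AddMonoidAlgebra K N)) :
    IsCriticalPoint f p ↔ jacobianIdeal f ≤ p.asIdeal := by
  rw [jacobianIdeal, Ideal.span_le, Set.range_subset_iff]
  exact forall_congr' fun m => Ideal.algebraMap_residueField_eq_zero

variable [Module.Free ℤ N] [Module.Finite ℤ N]

variable (N) in
/-- A family in `N` dual to the chosen basis of `M`. -/
theorem exists_dual_family : ∃ ν : Module.Free.ChooseBasisIndex ℤ (Module.Dual ℤ N) → N,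
    (∀ i j, Module.Free.chooseBasis ℤ (Module.Dual ℤ N) i (ν j) = if i = j then 1 else 0) ∧
    ∀ n, n = ∑ i, Module.Free.chooseBasis ℤ (Module.Dual ℤ N) i n • ν i := by
  classical
  let e := Module.Free.chooseBasis ℤ (Module.Dual ℤ N)
  have h1 : ∀ i j, e i ((Module.evalEquiv ℤ N).symm (e.dualBasis j)) = if i = j then 1 else 0 := by
    intro i j
    rw [Module.apply_evalEquiv_symm_apply, e.dualBasis_apply, e.repr_self, Finsupp.single_apply]
  refine ⟨fun i => (Module.evalEquiv ℤ N).symm (e.dualBasis i), h1, fun n => ?_⟩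
  apply (Module.evalEquiv ℤ N).injective
  refine e.ext fun i => ?_
  change e i n = e i (∑ j, e j n • (Module.evalEquiv ℤ N).symm (e.dualBasis j))
  simp only [map_sum, map_smul, h1, smul_eq_mul, mul_ite, mul_one, mul_zero, Finset.sum_ite_eq,
    Finset.mem_univ, if_true]

/-- The matrix of second log-derivatives, over the Laurent polynomial ring. -/
def hessianMatrix (f : AddMonoidAlgebra K N) :
    Matrix (Module.Free.ChooseBasisIndex ℤ (Module.Dual ℤ N))
      (Module.Free.ChooseBasisIndex ℤ (Module.Dual ℤ N)) (AddMonoidAlgebra K N) :=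
  Matrix.of fun i j => logDerivation K (Module.Free.chooseBasis ℤ (Module.Dual ℤ N) i)
    (logDerivation K (Module.Free.chooseBasis ℤ (Module.Dual ℤ N) j) f)

theorem hessian_eq_map (f : AddMonoidAlgebra K N) (p : PrimeSpectrum (AddMonoidAlgebra K N)) :
    hessian f p = (hessianMatrix f).map (algebraMap _ _) :=
  rfl

theorem isNondegenerateAt_iff (f : AddMonoidAlgebra K N)
    (p : PrimeSpectrum (AddMonoidAlgebra K N)) :
    IsNondegenerateAt f p ↔ (hessianMatrix f).det ∉ p.asIdeal := by
  rw [IsNondegenerateAt, hessian_eq_map, ← RingHom.mapMatrix_apply, ← RingHom.map_det, Ne,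
    Ideal.algebraMap_residueField_eq_zero]

/-- A quotient of the Laurent polynomial ring in which the log-derivatives of `f` vanish and the
Hessian of `f` is invertible is unramified. -/
theorem formallyUnramified_of_isUnit_hessian {f : AddMonoidAlgebra K N} {C : Type*} [CommRing C]
    [Algebra K C] (π : AddMonoidAlgebra K N →ₐ[K] C) (hπ : Function.Surjective π)
    (hf : ∀ m, π (logDerivation K m f) = 0) (hH : IsUnit (π (hessianMatrix f).det)) :
    Algebra.FormallyUnramified K C := by
  classical
  let : Algebra (AddMonoidAlgebra K N) C := π.toRingHom.toAlgebra
  have : IsScalarTower K (AddMonoidAlgebra K N) C :=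
    .of_algebraMap_eq fun r => (π.commutes r).symm
  let D : Derivation K (AddMonoidAlgebra K N) Ω[C⁄K] :=
    (KaehlerDifferential.D K C).compAlgebraMap (AddMonoidAlgebra K N)
  have hD : ∀ g, D g = KaehlerDifferential.D K C (π g) := fun g => rfl
  have hsmul : ∀ (g : AddMonoidAlgebra K N) (ω : Ω[C⁄K]), g • ω = π g • ω := fun g ω =>
    (algebraMap_smul C g ω).symm
  obtain ⟨ν, -, hν⟩ := exists_dual_family N
  let ω := fun i => (AddMonoidAlgebra.single (-ν i) (1 : K) : AddMonoidAlgebra K N) •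
    D (AddMonoidAlgebra.single (ν i) 1)
  have hform : ∀ g, D g = ∑ i, logDerivation K _ g • ω i := derivation_eq_sum_logDerivation hν D
  -- Differentiating the relation `∂_j f = 0` in `C` gives the `j`-th column of the Hessian as a
  -- relation among the `ω i`; the adjugate then gives `det • ω k = 0`.
  have hcol : ∀ j, ∑ i, hessianMatrix f i j • ω i = 0 := by
    intro j
    have h1 := hform (logDerivation K (Module.Free.chooseBasis ℤ (Module.Dual ℤ N) j) f)
    rw [hD, hf, map_zero] at h1
    exact h1.symm
  have hω : ∀ k, ω k = 0 := by
    intro k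
    have h1 : (hessianMatrix f).det • ω k = 0 := by
      calc (hessianMatrix f).det • ω k
          = ∑ i, (hessianMatrix f * (hessianMatrix f).adjugate) i k • ω i := by
            rw [Matrix.mul_adjugate]
            simp [Matrix.one_apply]
        _ = ∑ j, (hessianMatrix f).adjugate j k • ∑ i, hessianMatrix f i j • ω i := by
            simp only [Matrix.mul_apply, Finset.sum_smul, Finset.smul_sum, smul_smul]
            rw [Finset.sum_comm]
            simp only [mul_comm]
        _ = 0 := by simp [hcol]
    rw [hsmul] at h1
    exact hH.smul_eq_zero.mp h1
  have hzero : ∀ c, KaehlerDifferential.D K C c = 0 := by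
    intro c
    obtain ⟨g, rfl⟩ := hπ c
    rw [← hD, hform]
    simp [hω]
  refine ⟨?_⟩
  rw [← Submodule.subsingleton_iff C, ← subsingleton_iff_bot_eq_top,
    ← KaehlerDifferential.span_range_derivation K C, eq_comm, Submodule.span_eq_bot]
  rintro _ ⟨c, rfl⟩
  exact hzero c

end LogDerivations

/-! ### Reduced local rings and non-degenerate critical points. -/

section LocalStructure

variable {K : Type u} [Field K] {N : Type v} [AddCommGroup N] [Module.Free ℤ N] [Module.Finite ℤ N]

/-- If the Jacobian ideal generates the maximal ideal at a critical point and the residue field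
extension is separable, then the critical point is non-degenerate. -/
theorem hessian_notMem_of_forall_exists_mul_mem [PerfectField K] {f : AddMonoidAlgebra K N}
    [Module.Finite K (AddMonoidAlgebra K N ⧸ jacobianIdeal f)] {p : Ideal (AddMonoidAlgebra K N)}
    [p.IsPrime] (hp : jacobianIdeal f ≤ p)
    (hloc : ∀ x ∈ p, ∃ s ∉ p, s * x ∈ jacobianIdeal f) : (hessianMatrix f).det ∉ p := by
  classical
  intro hdet
  let κ := p.ResidueField
  have hκ : ∀ x : AddMonoidAlgebra K N, algebraMap _ κ x = 0 ↔ x ∈ p := fun x =>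
    Ideal.algebraMap_residueField_eq_zero
  have h0 : ((hessianMatrix f).map (algebraMap _ κ)).det = 0 := by
    rw [← RingHom.mapMatrix_apply, ← RingHom.map_det]
    exact (hκ _).mpr hdet
  obtain ⟨c, hc, hcA⟩ := Matrix.exists_vecMul_eq_zero_iff.mpr h0
  let e := Module.Free.chooseBasis ℤ (Module.Dual ℤ N)
  -- The null vector `c` of the Hessian defines the tangent vector `∑ c_i ∂_i` at `p`, which
  -- annihilates every `∂_m f`.
  let D : Derivation K (AddMonoidAlgebra K N) κ :=
    ∑ i, (LinearMap.toSpanSingleton (AddMonoidAlgebra K N) κ (c i)).compDer (logDerivation K (e i))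
  have hD : ∀ g, D g = ∑ i, c i * algebraMap _ κ (logDerivation K (e i) g) := by
    intro g
    have h1 : ⇑D = ∑ i, ⇑((LinearMap.toSpanSingleton (AddMonoidAlgebra K N) κ (c i)).compDer
        (logDerivation K (e i))) := map_sum Derivation.coeFnAddMonoidHom _ _
    rw [h1, Finset.sum_apply]
    refine Finset.sum_congr rfl fun i _ => ?_
    change logDerivation K (e i) g • c i = _
    rw [Algebra.smul_def, mul_comm]
  have hDf : ∀ m, D (logDerivation K m f) = 0 := by
    intro m
    change D (logDerivHom K f m) = 0
    rw [← e.sum_repr m, map_sum, map_sum]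
    refine Finset.sum_eq_zero fun j _ => ?_
    rw [map_zsmul, map_zsmul]
    have h1 : D (logDerivHom K f (e j)) = 0 := by
      rw [hD]
      exact congrFun hcA j
    rw [h1, smul_zero]
  have hDJ : ∀ g ∈ jacobianIdeal f, D g = 0 := by
    intro g hg
    induction hg using Submodule.span_induction with
    | mem g h => obtain ⟨m, rfl⟩ := h; exact hDf m
    | zero => exact map_zero D
    | add x y _ _ hx hy => rw [map_add, hx, hy, add_zero]
    | smul r x hx h =>
      rw [smul_eq_mul, D.leibniz, h, smul_zero, zero_add, Algebra.smul_def, (hκ x).mpr (hp hx),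
        zero_mul]
  -- In `D (s x) = s D x + x D s = 0` the last term vanishes in `κ` and `s` is invertible there.
  have hDp : ∀ x ∈ p, D x = 0 := by
    intro x hx
    obtain ⟨s, hs, hsx⟩ := hloc x hx
    have h1 := hDJ _ hsx
    rw [D.leibniz, Algebra.smul_def x, (hκ x).mpr hx, zero_mul, add_zero, Algebra.smul_def] at h1
    exact (mul_eq_zero.mp h1).resolve_left fun h => hs ((hκ s).mp h)
  have hD0 : ∀ g, D g = 0 := by
    intro g
    have hint : IsIntegral K (algebraMap _ κ g) := by
      let φ : (AddMonoidAlgebra K N ⧸ jacobianIdeal f) →ₐ[K] κ :=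
        Ideal.Quotient.liftₐ (jacobianIdeal f) (IsScalarTower.toAlgHom K (AddMonoidAlgebra K N) κ)
          fun x hx => (hκ x).mpr (hp hx)
      exact (Algebra.IsIntegral.isIntegral (R := K)
        (Ideal.Quotient.mk (jacobianIdeal f) g)).map φ
    -- With `μ` the minimal polynomial of the residue of `g`, `μ(g) ∈ p` gives `μ'(g) D g = 0` in
    -- `κ`, and separability makes `μ'(g)` non-zero there.
    have hsep := PerfectField.separable_of_irreducible (minpoly.irreducible hint)
    have h1 : Polynomial.aeval g (minpoly K (algebraMap _ κ g)) ∈ p := by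
      rw [← hκ, ← Polynomial.aeval_algebraMap_apply, minpoly.aeval]
    have h2 := hDp _ h1
    rw [D.map_aeval, Algebra.smul_def, ← Polynomial.aeval_algebraMap_apply] at h2
    exact (mul_eq_zero.mp h2).resolve_left
      (hsep.aeval_derivative_ne_zero (minpoly.aeval K (algebraMap _ κ g)))
  obtain ⟨ν, hν, -⟩ := exists_dual_family N
  apply hc
  funext k
  -- On the unit `x^{ν_k}` only `∂_k` is non-zero, so `D = 0` forces `c k = 0`.
  have h1 := hD0 (AddMonoidAlgebra.single (ν k) 1)
  have hk : ∀ i, e i (ν k) = if i = k then 1 else 0 := fun i => hν i k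
  rw [hD, Finset.sum_eq_single k] at h1
  · have h2 : logDerivation K (e k) (AddMonoidAlgebra.single (ν k) 1) =
        AddMonoidAlgebra.single (ν k) (1 : K) := by
      rw [logDerivation_apply, logDeriv_single]
      simp [hk]
    rw [h2] at h1
    refine (mul_eq_zero.mp h1).resolve_right fun h => ?_
    have h3 := congrArg (algebraMap _ κ) (single_neg_mul_single (K := K) (ν k))
    rw [map_mul, h, mul_zero, map_one] at h3
    exact zero_ne_one h3
  · intro i _ hik
    have h2 : logDerivation K (e i) (AddMonoidAlgebra.single (ν k) (1 : K)) = 0 := by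
      rw [logDerivation_apply, logDeriv_single]
      simp [hk, hik]
    rw [h2, map_zero, mul_zero]
  · simp

/-- At a prime with reduced local ring of an Artinian ring, the prime is locally zero. -/
theorem exists_notMem_mul_eq_zero_of_isReduced {B : Type*} [CommRing B] [IsArtinianRing B]
    (q : Ideal B) [q.IsPrime] [IsReduced (Localization.AtPrime q)] :
    ∃ s ∉ q, ∀ x ∈ q, s * x = 0 := by
  classical
  have hfield := IsArtinianRing.isField_of_isReduced_of_isLocalRing (Localization.AtPrime q)
  have hloc : ∀ x ∈ q, ∃ s ∉ q, s * x = 0 := by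
    intro x hx
    have h1 : algebraMap B (Localization.AtPrime q) x = 0 := by
      have h2 := (IsLocalization.AtPrime.to_map_mem_maximal_iff (Localization.AtPrime q) q x).mpr hx
      rwa [IsLocalRing.isField_iff_maximalIdeal_eq.mp hfield] at h2
    obtain ⟨s, hs⟩ := (IsLocalization.map_eq_zero_iff q.primeCompl _ x).mp h1
    exact ⟨s, s.2, hs⟩
  obtain ⟨t, ht⟩ := (isNoetherianRing_iff_ideal_fg B).mp inferInstance q
  have hmem : ∀ x ∈ t, x ∈ q := fun x hx => ht ▸ Ideal.subset_span hx
  choose! s hs hsx using hloc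
  -- Each element of `q` dies in the local ring, which is a field; one multiplier for all of `q` is
  -- the product over finitely many generators.
  refine ⟨∏ x ∈ t, s x, fun h => ?_, fun x hx => ?_⟩
  · obtain ⟨x, hx, h⟩ := (‹q.IsPrime›.prod_mem_iff).mp h
    exact hs x (hmem x hx) h
  · rw [← ht] at hx
    induction hx using Submodule.span_induction with
    | mem x hx =>
      rw [← Finset.prod_erase_mul _ _ hx, mul_assoc, hsx x (hmem x hx), mul_zero]
    | zero => exact mul_zero _
    | add x y _ _ hx hy => rw [mul_add, hx, hy, add_zero]
    | smul r x _ h => rw [smul_eq_mul, mul_left_comm, h, mul_zero]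

/-- A finite algebra in which some prime is locally zero contains a field as a direct summand. -/
theorem containsFieldAsDirectSummand_of_mul_eq_zero {B : Type v} [CommRing B] [Algebra K B]
    [Module.Finite K B] {q : Ideal B} [hq : q.IsPrime] {s : B} (hs : s ∉ q)
    (hsq : ∀ x ∈ q, s * x = 0) : ContainsFieldAsDirectSummand K B := by
  have : IsArtinianRing B := IsArtinianRing.of_finite K B
  have hmax : q.IsMaximal := IsArtinianRing.isMaximal_of_isPrime q
  -- Since `q` is maximal and `s ∉ q`, these ideals are coprime; their product is zero, so the
  -- Chinese remainder theorem splits off the field `B ⧸ q`.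
  have hcop : IsCoprime q (Ideal.span {s}) := by
    rw [Ideal.isCoprime_iff_sup_eq]
    refine hmax.1.2 _ (lt_of_le_of_ne le_sup_left fun h => hs ?_)
    rw [h]
    exact Ideal.mem_sup_right (Ideal.mem_span_singleton_self s)
  have hbot : q * Ideal.span {s} = ⊥ := by
    rw [eq_bot_iff, Ideal.mul_le]
    intro x hx y hy
    obtain ⟨z, rfl⟩ := Ideal.mem_span_singleton'.mp hy
    rw [Ideal.mem_bot, mul_left_comm, mul_comm x, hsq x hx, mul_zero]
  let φ : B →ₐ[K] (B ⧸ q) × (B ⧸ Ideal.span {s}) :=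
    (Ideal.Quotient.mkₐ K q).prod (Ideal.Quotient.mkₐ K _)
  have hφ : Function.Bijective φ := by
    constructor
    · rw [injective_iff_map_eq_zero]
      intro x hx
      have h1 : x ∈ q ⊓ Ideal.span {s} :=
        ⟨Ideal.Quotient.eq_zero_iff_mem.mp (congrArg Prod.fst hx),
          Ideal.Quotient.eq_zero_iff_mem.mp (congrArg Prod.snd hx)⟩
      rwa [← Ideal.mul_eq_inf_of_coprime (Ideal.isCoprime_iff_sup_eq.mp hcop), hbot] at h1
    · intro y
      obtain ⟨x, hx⟩ := (Ideal.quotientMulEquivQuotientProd q (Ideal.span {s}) hcop).surjective y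
      obtain ⟨x, rfl⟩ := Ideal.Quotient.mk_surjective x
      exact ⟨x, hx⟩
  exact ⟨B ⧸ q, B ⧸ Ideal.span {s}, Ideal.Quotient.field q, inferInstance, inferInstance,
    inferInstance, ⟨AlgEquiv.ofBijective φ hφ⟩⟩

/-- A direct summand that is a field is supported at a locally zero prime. -/
theorem ContainsFieldAsDirectSummand.exists_mul_eq_zero {B : Type v} [CommRing B] [Algebra K B]
    (h : ContainsFieldAsDirectSummand K B) :
    ∃ q : Ideal B, q.IsPrime ∧ ∃ s ∉ q, ∀ x ∈ q, s * x = 0 := by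
  obtain ⟨L, A', _, _, _, _, ⟨e⟩⟩ := h
  let φ : B →+* L := (RingHom.fst L A').comp e.toRingEquiv.toRingHom
  refine ⟨RingHom.ker φ, RingHom.ker_isPrime φ, e.symm (1, 0), ?_, fun x hx => ?_⟩
  · intro h
    have h1 : (e (e.symm ((1 : L), (0 : A')))).1 = 0 := h
    rw [e.apply_symm_apply] at h1
    exact one_ne_zero h1
  · have h1 : (e x).1 = 0 := hx
    apply e.injective
    rw [map_mul, e.apply_symm_apply, map_zero]
    ext <;> simp [h1]

theorem ContainsFieldAsDirectSummand.of_algEquiv {B B' : Type v} [CommRing B] [Algebra K B]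
    [CommRing B'] [Algebra K B'] (e : B ≃ₐ[K] B') (h : ContainsFieldAsDirectSummand K B') :
    ContainsFieldAsDirectSummand K B := by
  obtain ⟨L, A', i1, i2, i3, i4, ⟨e'⟩⟩ := h
  exact ⟨L, A', i1, i2, i3, i4, ⟨e.trans e'⟩⟩

theorem IsSemisimpleAlgebra.of_algEquiv {B B' : Type v} [CommRing B] [Algebra K B]
    [CommRing B'] [Algebra K B'] (e : B ≃ₐ[K] B') (h : IsSemisimpleAlgebra K B') :
    IsSemisimpleAlgebra K B :=
  have := h.1
  ⟨.equiv e.symm.toLinearEquiv, fun a ha => by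
    have h1 := h.2 (e a) (ha.map e)
    exact e.injective (h1.trans (map_zero e).symm)⟩

/-- The local ring of the critical scheme at a non-degenerate critical point is reduced. -/
theorem exists_notMem_mul_eq_zero_of_hessian_notMem {f : AddMonoidAlgebra K N}
    [Module.Finite K (AddMonoidAlgebra K N ⧸ jacobianIdeal f)]
    (q : Ideal (AddMonoidAlgebra K N ⧸ jacobianIdeal f)) [q.IsPrime]
    (hH : Ideal.Quotient.mk _ (hessianMatrix f).det ∉ q) : ∃ s ∉ q, ∀ x ∈ q, s * x = 0 := by
  let B := AddMonoidAlgebra K N ⧸ jacobianIdeal f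
  have : IsArtinianRing B := IsArtinianRing.of_finite K B
  let C := Localization.AtPrime q
  -- Localizations of an Artinian ring are quotients of it, so `C` is a quotient of the Laurent
  -- polynomial ring and the Hessian criterion applies.
  have hsurj : Function.Surjective (algebraMap B C) :=
    IsArtinianRing.localization_surjective q.primeCompl C
  let π : AddMonoidAlgebra K N →ₐ[K] C :=
    (IsScalarTower.toAlgHom K B C).comp (Ideal.Quotient.mkₐ K (jacobianIdeal f))
  have : Algebra.FormallyUnramified K C := by
    refine formallyUnramified_of_isUnit_hessian (f := f) π
      (hsurj.comp (Ideal.Quotient.mkₐ_surjective K (jacobianIdeal f))) (fun m => ?_) ?_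
    · change algebraMap B C (Ideal.Quotient.mk _ _) = 0
      rw [Ideal.Quotient.eq_zero_iff_mem.mpr (mem_jacobianIdeal f m), map_zero]
    · exact IsLocalization.map_units C (⟨_, hH⟩ : q.primeCompl)
  have : Module.Finite K C :=
    .of_surjective (IsScalarTower.toAlgHom K B C).toLinearMap hsurj
  have : IsReduced C := Algebra.FormallyUnramified.isReduced_of_field K C
  exact exists_notMem_mul_eq_zero_of_isReduced q

theorem hessian_notMem_of_exists_mul_eq_zero [PerfectField K] {f : AddMonoidAlgebra K N}
    [Module.Finite K (AddMonoidAlgebra K N ⧸ jacobianIdeal f)]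
    {q : Ideal (AddMonoidAlgebra K N ⧸ jacobianIdeal f)} [q.IsPrime]
    (h : ∃ s ∉ q, ∀ x ∈ q, s * x = 0) : Ideal.Quotient.mk _ (hessianMatrix f).det ∉ q := by
  obtain ⟨s, hs, hsq⟩ := h
  obtain ⟨s, rfl⟩ := Ideal.Quotient.mk_surjective s
  refine hessian_notMem_of_forall_exists_mul_mem (p := q.comap (Ideal.Quotient.mk _)) ?_ ?_
  · intro x hx
    rw [Ideal.mem_comap, Ideal.Quotient.eq_zero_iff_mem.mpr hx]
    exact zero_mem q
  · intro x hx
    refine ⟨s, hs, ?_⟩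
    rw [← Ideal.Quotient.eq_zero_iff_mem, map_mul]
    exact hsq _ hx

theorem isSemisimpleAlgebra_quotient_jacobianIdeal_iff [PerfectField K] (f : AddMonoidAlgebra K N)
    [Module.Finite K (AddMonoidAlgebra K N ⧸ jacobianIdeal f)] :
    IsSemisimpleAlgebra K (AddMonoidAlgebra K N ⧸ jacobianIdeal f) ↔
      ∀ p, IsCriticalPoint f p → IsNondegenerateAt f p := by
  let B := AddMonoidAlgebra K N ⧸ jacobianIdeal f
  have : IsArtinianRing B := IsArtinianRing.of_finite K B
  constructor
  · rintro ⟨-, hred⟩ p hp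
    have : IsReduced B := ⟨hred⟩
    rw [isCriticalPoint_iff] at hp
    rw [isNondegenerateAt_iff]
    refine hessian_notMem_of_forall_exists_mul_mem hp fun x hx => ?_
    let q : Ideal B := p.asIdeal.map (Ideal.Quotient.mk (jacobianIdeal f))
    have hqp : q.comap (Ideal.Quotient.mk (jacobianIdeal f)) = p.asIdeal :=
      Ideal.comap_map_quotientMk _ _ |>.trans (sup_eq_right.mpr hp)
    have hq : q.IsPrime := Ideal.map_isPrime_of_surjective Ideal.Quotient.mk_surjective
      (by rwa [Ideal.mk_ker])
    obtain ⟨s, hs, hsq⟩ := exists_notMem_mul_eq_zero_of_isReduced q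
    obtain ⟨s, rfl⟩ := Ideal.Quotient.mk_surjective s
    refine ⟨s, fun h => hs (Ideal.mem_map_of_mem _ h), ?_⟩
    rw [← Ideal.Quotient.eq_zero_iff_mem, map_mul]
    exact hsq _ (Ideal.mem_map_of_mem _ hx)
  · intro h
    -- Maximal ideals of the quotient are critical points, so the determinant lies in none of them,
    -- and the Hessian criterion applies to the whole quotient at once.
    have hunit : IsUnit (Ideal.Quotient.mk (jacobianIdeal f) (hessianMatrix f).det) := by
      by_contra hnot
      obtain ⟨q, hq, hmem⟩ := exists_max_ideal_of_mem_nonunits hnot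
      have hqp := hq.isPrime
      let p : PrimeSpectrum (AddMonoidAlgebra K N) :=
        ⟨q.comap (Ideal.Quotient.mk (jacobianIdeal f)), inferInstance⟩
      refine (isNondegenerateAt_iff f p).mp (h p ((isCriticalPoint_iff f p).mpr ?_)) hmem
      intro x hx
      change Ideal.Quotient.mk _ x ∈ q
      rw [Ideal.Quotient.eq_zero_iff_mem.mpr hx]
      exact zero_mem q
    have : Algebra.FormallyUnramified K B :=
      formallyUnramified_of_isUnit_hessian (Ideal.Quotient.mkₐ K (jacobianIdeal f))
        (Ideal.Quotient.mkₐ_surjective K _)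
        (fun m => Ideal.Quotient.eq_zero_iff_mem.mpr (mem_jacobianIdeal f m)) hunit
    have : IsReduced B := Algebra.FormallyUnramified.isReduced_of_field K B
    exact ⟨inferInstance, fun a ha => ha.eq_zero⟩

/-- Both sides amount to a prime `q` of the quotient annihilated by some `s ∉ q`: this is how a
field factor is detected, and it is equivalent to the Hessian determinant lying outside `q`. -/
theorem containsFieldAsDirectSummand_quotient_jacobianIdeal_iff [PerfectField K]
    (f : AddMonoidAlgebra K N) [Module.Finite K (AddMonoidAlgebra K N ⧸ jacobianIdeal f)] :
    ContainsFieldAsDirectSummand K (AddMonoidAlgebra K N ⧸ jacobianIdeal f) ↔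
      ∃ p, IsCriticalPoint f p ∧ IsNondegenerateAt f p := by
  let B := AddMonoidAlgebra K N ⧸ jacobianIdeal f
  constructor
  · intro h
    obtain ⟨q, hq, hsq⟩ := h.exists_mul_eq_zero
    refine ⟨⟨q.comap (Ideal.Quotient.mk (jacobianIdeal f)), inferInstance⟩, ?_, ?_⟩
    · rw [isCriticalPoint_iff]
      intro x hx
      change Ideal.Quotient.mk _ x ∈ q
      rw [Ideal.Quotient.eq_zero_iff_mem.mpr hx]
      exact zero_mem q
    · rw [isNondegenerateAt_iff]
      exact hessian_notMem_of_exists_mul_eq_zero hsq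
  · rintro ⟨p, hp, hH⟩
    rw [isCriticalPoint_iff] at hp
    rw [isNondegenerateAt_iff] at hH
    let q : Ideal B := p.asIdeal.map (Ideal.Quotient.mk (jacobianIdeal f))
    have hqp : q.comap (Ideal.Quotient.mk (jacobianIdeal f)) = p.asIdeal :=
      Ideal.comap_map_quotientMk _ _ |>.trans (sup_eq_right.mpr hp)
    have hq : q.IsPrime := Ideal.map_isPrime_of_surjective Ideal.Quotient.mk_surjective
      (by rwa [Ideal.mk_ker])
    obtain ⟨s, hs, hsq⟩ := exists_notMem_mul_eq_zero_of_hessian_notMem q (fun h => hH (hqp ▸ h))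
    exact containsFieldAsDirectSummand_of_mul_eq_zero hs hsq

end LocalStructure

end ToricFano

end

open ToricFano in
theorem corollary3p6 {K : Type*} [Field K] [PerfectField K]
    {N : Type*} [AddCommGroup N] [Module.Free ℤ N] [Module.Finite ℤ N]
    (S : Fan N) (hsmooth : S.IsSmooth) (hfano : S.IsFano)
    (b : S.rayVectors → K) (hb : ∀ ρ, b ρ ≠ 0) :
    Module.Finite K (S.criticalFunctions b) ∧
    Nonempty (S.criticalFunctions b ≃ₐ[K]
      (AddMonoidAlgebra K N ⧸ jacobianIdeal (S.potential b))) ∧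
    (IsSemisimpleAlgebra K (S.criticalFunctions b) ↔
      ∀ p, IsCriticalPoint (S.potential b) p → IsNondegenerateAt (S.potential b) p) ∧
    (ContainsFieldAsDirectSummand K (S.criticalFunctions b) ↔
      ∃ p, IsCriticalPoint (S.potential b) p ∧ IsNondegenerateAt (S.potential b) p) := by
  have hfin := S.finite_criticalFunctions hsmooth hfano hb
  obtain ⟨e⟩ := S.nonempty_criticalFunctions_algEquiv hsmooth hfano hb
  have : Module.Finite K (AddMonoidAlgebra K N ⧸ jacobianIdeal (S.potential b)) :=
    .equiv e.toLinearEquiv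
  refine ⟨hfin, ⟨e⟩, ?_, ?_⟩
  · rw [← isSemisimpleAlgebra_quotient_jacobianIdeal_iff]
    exact ⟨.of_algEquiv e.symm, .of_algEquiv e⟩
  · rw [← containsFieldAsDirectSummand_quotient_jacobianIdeal_iff]
    exact ⟨.of_algEquiv e.symm, .of_algEquiv e⟩
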